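/- Let $m\ge 2$ and $n\ge 1$, let $M$ be a smooth $m$-manifold with volume form $\eta$, and let $\pi\colon E\to M$ be a smooth fibre bundle (or, more generally, a surjective submersion) with $\dim E=m+n$. Adapted charts $(x^i,u^\alpha)$ of $E$ induce coordinates $(x^i,u^\alpha,u^\alpha_I)$, $1\le|I|\le k$, on the jet bundles $J^k\pi$. Let $\Lambda_2^m(J^1\pi)$ be the bundle of $m$-covectors on $J^1\pi$ that vanish on any two vectors vertical over $M$; its elements are locally written $$p\,d^mx+p^i_\alpha\,du^\alpha\wedge d^{m-1}x_i+p^{ij}_\alpha\,du^\alpha_i\wedge d^{m-1}x_j ,$$ where $d^mx=dx^1\wedge\dots\wedge dx^m$ and $d^{m-1}x_i=i(\partial/\partial x^i)d^mx$. Let $J^2\pi^\dagger\subset\Lambda_2^m(J^1\pi)$ be the subbundle $p^{ij}_\alpha=p^{ji}_\alpha$, and let $\Omega_1^s=-d\Theta_1^s$, where $\Theta_1^s$ is the restriction to $J^2\pi^\dagger$ of the tautological $m$-form. Let $\mu\colon J^2\pi^\dagger\to J^2\pi^\ddagger=J^2\pi^\dagger/\Lambda_1^m(J^1\pi)$ be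 the quotient by the $m$-covectors that are semibasic over $M$; $J^2\pi^\ddagger$ has coordinates $(x^i,u^\alpha,u^\alpha_i,p^i_\alpha,p^I_\alpha)$, $|I|=2$, with $p^{ij}_\alpha=\frac1{n(ij)}p^{1_i+1_j}_\alpha$, $n(ii)=1$, and $n(ij)=2$ for $i\ne j$. Let $\mathcal L=L\,\eta$, with $L\in C^\infty(J^2\pi)$, be a second-order Lagrangian density. Its restricted Legendre map $\mathcal{FL}\colon J^3\pi\to J^2\pi^\ddagger$ is the bundle map over $J^1\pi$ given, in adapted charts with $\eta=d^mx$, by $$p^i_\alpha=\frac{\partial L}{\partial u^\alpha_i}-\sum_{j=1}^m\frac1{n(ij)}\frac{d}{dx^j}\frac{\partial L}{\partial u^\alpha_{1_i+1_j}},\qquad p^I_\alpha=\frac{\partial L}{\partial u^\alpha_I},$$ where $d/dx^j$ are the total derivatives. Suppose that $\mathcal L$ is hyperregular, that is, $\mathcal{FL}$ has rank $\dim J^2\pi^\ddagger$ everywhere and admits a smooth global section. Let $\Upsilon\colon J^2\pi^\ddagger\to J^3\pi$ be any smooth global section of $\mathcal{FL}$, and let $h\colon J^2\pi^\ddagger\to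 J^2\pi^\dagger$ be the corresponding Hamiltonian section of $\mu$: for $w\in J^2\pi^\ddagger$, $h(w)$ is the unique $\omega\in J^2\pi^\dagger$ with $\mu(\omega)=w$ and $(j^1\phi)^*\omega=L(j^2_x\phi)\,\eta_x$, where $\Upsilon(w)=j^3_x\phi$. Then the Hamilton–Cartan form $\Omega_h=h^*\Omega_1^s\in\Omega^{m+1}(J^2\pi^\ddagger)$ is multisymplectic: it is a smooth form of degree $m+1\le\dim J^2\pi^\ddagger$, it is closed, and it is $1$-nondegenerate, that is, at every point $w$ and for every $Y\in T_wJ^2\pi^\ddagger$ one has $i(Y)(\Omega_h)_w=0$ if and only if $Y=0$. -/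

import Mathlib

open scoped Manifold ContDiff Topology

noncomputable section

namespace SecondOrderField

/-! ### Coordinate spaces

Multi-indices of length `r` are elements of `Sym (Fin m) r`; the multi-index `1_i + 1_j` is
`{i, j}`, and `I + 1_j` is `j ::ₛ I`. -/

/-- Coordinates `(x^i)` on the base. -/
abbrev X (m : ℕ) := EuclideanSpace ℝ (Fin m)

/-- Coordinates `(u^α)` on the fibres. -/
abbrev U (n : ℕ) := EuclideanSpace ℝ (Fin n)

/-- Coordinates `(x^i, u^α, u_i^α)` of first jets. -/
abbrev V1 (m n : ℕ) := X m × U n × (Fin m → U n)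

/-- Coordinates `(x^i, u^α, u_i^α, u_I^α)`, `|I| = 2`, of second jets. -/
abbrev V2 (m n : ℕ) := V1 m n × (Sym (Fin m) 2 → U n)

/-- Coordinates `(x^i, u^α, u_i^α, u_I^α, u_J^α)`, `|I| = 2`, `|J| = 3`, of third jets. -/
abbrev V3 (m n : ℕ) := V2 m n × (Sym (Fin m) 3 → U n)

/-- The multi-index `1_i + 1_j`. -/
def idx2 {m : ℕ} (i j : Fin m) : Sym (Fin m) 2 := i ::ₛ j ::ₛ Sym.nil

/-- The number `n(ij)`. -/
def nij {m : ℕ} (i j : Fin m) : ℝ := if i = j then 1 else 2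

/-- The `i`-th standard basis vector. -/
def e {k : ℕ} (i : Fin k) : EuclideanSpace ℝ (Fin k) := EuclideanSpace.single i 1

/-- The partial derivative `∂^I f` at `x`.  (Only applied to maps smooth near `x`, for which the
order of the differentiations does not matter.) -/
def pderiv {m n r : ℕ} (I : Sym (Fin m) r) (f : X m → U n) (x : X m) : U n :=
  iteratedFDeriv ℝ r f x
    (fun a : Fin r => e ((I : Multiset (Fin m)).toList.get (Fin.cast (by simp) a)))

/-- Local expression of the first prolongation of the section `x ↦ (x, f x)`. -/
def prolong1 {m n : ℕ} (f : X m → U n) (x : X m) : V1 m n := (x, f x, fun i => fderiv ℝ f x (e i))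

/-- Local expression of the second prolongation. -/
def prolong2 {m n : ℕ} (f : X m → U n) (x : X m) : V2 m n := (prolong1 f x, fun I => pderiv I f x)

/-- Local expression of the third prolongation. -/
def prolong3 {m n : ℕ} (f : X m → U n) (x : X m) : V3 m n := (prolong2 f x, fun J => pderiv J f x)

/-- The coordinate vector field `∂/∂x^i` on first jets. -/
def dX {m n : ℕ} (i : Fin m) : V1 m n := (e i, 0, 0)

/-- The coordinate vector field `∂/∂u^α` on first jets. -/
def dU {m n : ℕ} (α : Fin n) : V1 m n := (0, e α, 0)

/-- The coordinate vector field `∂/∂u_i^α` on first jets. -/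
def dU1 {m n : ℕ} (i : Fin m) (α : Fin n) : V1 m n := (0, 0, Pi.single i (e α))

/-- The local expression `F ∘ coord⁻¹` of a map `F` in a coordinate system `coord` with domain `dom`
(injective on `dom`), extended by `0` outside of the range of the coordinates. -/
def localExpr {N V Y : Type*} [Zero Y] (dom : Set N) (coord : N → V) (F : N → Y) : V → Y :=
  Function.extend (fun p : dom => coord p) (fun p : dom => F p) 0

/-! ### Forms on the coordinate space of first jets -/

/-- Vanishing under contraction with two vectors that are vertical over the base. -/
def VanishesOnTwoVertical {m n : ℕ} (ξ : V1 m n [⋀^Fin m]→L[ℝ] ℝ) : Prop :=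
  ∀ (v : Fin m → V1 m n) (a b : Fin m), a ≠ b → (v a).1 = 0 → (v b).1 = 0 → ξ v = 0

/-- Vanishing under contraction with one vector that is vertical over the base. -/
def IsSemibasic {m n : ℕ} (ξ : V1 m n [⋀^Fin m]→L[ℝ] ℝ) : Prop :=
  ∀ (v : Fin m → V1 m n) (a : Fin m), (v a).1 = 0 → ξ v = 0

/-- The coefficient `p^i_α` of `du^α ∧ d^{m-1}x_i` in `ξ`; note that `du^α ∧ d^{m-1}x_i` is
`dx^1 ∧ … ∧ dx^m` with the factor `dx^i` replaced by `du^α`. -/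
def mom1 {m n : ℕ} (ξ : V1 m n [⋀^Fin m]→L[ℝ] ℝ) (i : Fin m) (α : Fin n) : ℝ :=
  ξ (Function.update (fun k => dX k) i (dU α))

/-- The coefficient `p^{ij}_α` of `du^α_i ∧ d^{m-1}x_j` in `ξ`. -/
def mom2 {m n : ℕ} (ξ : V1 m n [⋀^Fin m]→L[ℝ] ℝ) (i j : Fin m) (α : Fin n) : ℝ :=
  ξ (Function.update (fun k => dX k) j (dU1 i α))

/-- The space of values of 2-symmetric multimomenta in natural coordinates. -/
def SymMom (m n : ℕ) : Submodule ℝ (V1 m n [⋀^Fin m]→L[ℝ] ℝ) where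
  carrier := {ξ | VanishesOnTwoVertical ξ ∧ ∀ i j α, mom2 ξ i j α = mom2 ξ j i α}
  add_mem' := by
    rintro ξ ξ' ⟨h1, h2⟩ ⟨h1', h2'⟩
    refine ⟨fun v a b hab ha hb => ?_, fun i j α => ?_⟩
    · simp [h1 v a b hab ha hb, h1' v a b hab ha hb]
    · have h := h2 i j α
      have h' := h2' i j α
      simp only [mom2] at h h' ⊢
      simp [h, h']
  zero_mem' := ⟨fun _ _ _ _ _ _ => rfl, fun _ _ _ => rfl⟩
  smul_mem' := by
    rintro t ξ ⟨h1, h2⟩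
    refine ⟨fun v a b hab ha hb => ?_, fun i j α => ?_⟩
    · simp [h1 v a b hab ha hb]
    · have h := h2 i j α
      simp only [mom2] at h ⊢
      simp [h]

/-- Coordinates of the extended 2-symmetric multimomentum bundle: the coordinates of a first jet
and an element of the linear space `SymMom` (on which `p`, `p^i_α`, `p^{ij}_α = p^{ji}_α` are linear
coordinates). -/
abbrev VDag (m n : ℕ) := V1 m n × SymMom m n

/-- Coordinates `(x^i, u^α, u_i^α, p^i_α, p^I_α)`, `|I| = 2`, of the restricted 2-symmetric
multimomentum bundle. -/
abbrev VDDag (m n : ℕ) := V1 m n × (Fin m → Fin n → ℝ) × (Sym (Fin m) 2 → Fin n → ℝ)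

/-- Tautological (Liouville) `m`-form `Θ₁ˢ` in natural coordinates:
`Θ(ξ)(X_1, …, X_m) = ξ(Tpr X_1, …, Tpr X_m)`, `pr` the projection to first jets. -/
def liouville (m n : ℕ) (q : VDag m n) : VDag m n [⋀^Fin m]→L[ℝ] ℝ :=
  (q.2 : V1 m n [⋀^Fin m]→L[ℝ] ℝ).compContinuousLinearMap
    (ContinuousLinearMap.fst ℝ (V1 m n) (SymMom m n))

/-- The Liouville `(m+1)`-form `Ω₁ˢ = -dΘ₁ˢ` in natural coordinates. -/
def liouvilleD (m n : ℕ) (q : VDag m n) : VDag m n [⋀^Fin (m + 1)]→L[ℝ] ℝ :=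
  -(extDeriv (𝕜 := ℝ) (E := VDag m n) (F := ℝ) (n := m) (liouville m n) q)

/-! ### Bundles, adapted charts, jets -/

section Bundle

variable (m n : ℕ) {M E : Type*}
  [TopologicalSpace M] [ChartedSpace (X m) M]
  [TopologicalSpace E] [ChartedSpace (X m × U n) E]

/-- `π` is a fibred manifold (surjective submersion), e.g. a smooth fibre bundle. -/
structure IsFibredManifold (π : E → M) : Prop where
  surjective : Function.Surjective π
  smooth : ContMDiff 𝓘(ℝ, X m × U n) (𝓡 m) ∞ π
  submersion : ∀ y : E, Function.Surjective (mfderiv 𝓘(ℝ, X m × U n) (𝓡 m) π y)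

/-- Local charts `(x^i, u^α)` of `E` adapted to `π`, together with the chart `(x^i)` of `M`. -/
structure AdaptedChart (π : E → M) where
  total : OpenPartialHomeomorph E (X m × U n)
  base : OpenPartialHomeomorph M (X m)
  total_mem : total ∈ IsManifold.maximalAtlas 𝓘(ℝ, X m × U n) ∞ E
  base_mem : base ∈ IsManifold.maximalAtlas (𝓡 m) ∞ M
  mapsTo : ∀ y ∈ total.source, π y ∈ base.source
  adapted : ∀ y ∈ total.source, (total y).1 = base (π y)

/-- A (smooth) local section of `π` around the point `pt`. -/
structure LocalSection (π : E → M) where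
  pt : M
  toFun : M → E
  smooth : ∀ᶠ x in 𝓝 pt, ContMDiffAt (𝓡 m) 𝓘(ℝ, X m × U n) ∞ toFun x
  isSection : ∀ᶠ x in 𝓝 pt, π (toFun x) = x

/-- A volume form on `M` (smooth, nowhere vanishing `m`-form). -/
structure VolumeForm (M : Type*) [TopologicalSpace M] [ChartedSpace (X m) M] where
  form : (x : M) → TangentSpace (𝓡 m) x [⋀^Fin m]→L[ℝ] ℝ
  ne_zero : ∀ x, form x ≠ 0
  smooth : ∀ ψ ∈ IsManifold.maximalAtlas (𝓡 m) ∞ M, ContDiffOn ℝ ∞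
    (fun y : X m => form (ψ.symm y) (fun k => mfderiv (𝓡 m) (𝓡 m) ψ.symm y (e k : X m))) ψ.target

variable {m n} {π : E → M}

/-- The function `f` such that a section reads `x ↦ (x, f x)` in the chart `c`. -/
def AdaptedChart.localRep (c : AdaptedChart m n π) (φ : M → E) : X m → U n :=
  fun y => (c.total (φ (c.base.symm y))).2

/-- The coefficient of `η` with respect to `dx^1 ∧ … ∧ dx^m` in the chart `c`, at `x`. -/
def AdaptedChart.volCoeff (c : AdaptedChart m n π) (η : VolumeForm m M) (x : M) : ℝ :=
  η.form (c.base.symm (c.base x))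
    (fun k => mfderiv (𝓡 m) (𝓡 m) c.base.symm (c.base x) (e k : X m))

variable (m n π) in
/-- Equality of `k`-jets: same base point, same value, and equal partial derivatives up to order
`k` in adapted coordinates. -/
def jetSetoid (k : ℕ) : Setoid (LocalSection m n π) where
  r s t := s.pt = t.pt ∧ s.toFun s.pt = t.toFun t.pt ∧
    ∀ c : AdaptedChart m n π, s.toFun s.pt ∈ c.total.source → ∀ r ≤ k,
      iteratedFDeriv ℝ r (c.localRep s.toFun) (c.base s.pt) =
        iteratedFDeriv ℝ r (c.localRep t.toFun) (c.base t.pt)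
  iseqv :=
    { refl := fun _ => ⟨rfl, rfl, fun _ _ _ _ => rfl⟩
      symm := fun h => ⟨h.1.symm, h.2.1.symm, fun c hc r hr => (h.2.2 c (h.2.1 ▸ hc) r hr).symm⟩
      trans := fun h h' => ⟨h.1.trans h'.1, h.2.1.trans h'.2.1, fun c hc r hr =>
        (h.2.2 c hc r hr).trans (h'.2.2 c (h.2.1 ▸ hc) r hr)⟩ }

variable (m n π) in
/-- The `k`-th order jet bundle `J^kπ`. -/
def Jet (k : ℕ) := Quotient (jetSetoid m n π k)

namespace Jet

/-- A local section representing the jet. -/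
def rep {k : ℕ} (j : Jet m n π k) : LocalSection m n π := Quotient.out j

/-- The projection `J^kπ → M`. -/
def base {k : ℕ} (j : Jet m n π k) : M :=
  Quotient.lift (s := jetSetoid m n π k) (fun s => s.pt) (fun _ _ h => h.1) j

/-- The projection `J^kπ → E`. -/
def point {k : ℕ} (j : Jet m n π k) : E :=
  Quotient.lift (s := jetSetoid m n π k) (fun s => s.toFun s.pt) (fun _ _ h => h.2.1) j

/-- The projection `J^kπ → J^rπ`, `r ≤ k`. -/
def proj {k : ℕ} (r : ℕ) (hr : r ≤ k) : Jet m n π k → Jet m n π r :=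
  Quotient.map' id (fun _ _ h => ⟨h.1, h.2.1, fun c hc a ha => h.2.2 c hc a (ha.trans hr)⟩)

end Jet

namespace AdaptedChart

variable (c : AdaptedChart m n π)

/-- Domain of the natural chart of `J^kπ` induced by `c`. -/
def jetDom (k : ℕ) : Set (Jet m n π k) := {j | j.point ∈ c.total.source}

/-- Natural coordinates of `J¹π`. -/
def coord1 (j : Jet m n π 1) : V1 m n := prolong1 (c.localRep j.rep.toFun) (c.base j.rep.pt)

/-- Natural coordinates of `J²π`. -/
def coord2 (j : Jet m n π 2) : V2 m n := prolong2 (c.localRep j.rep.toFun) (c.base j.rep.pt)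

/-- Natural coordinates of `J³π`. -/
def coord3 (j : Jet m n π 3) : V3 m n := prolong3 (c.localRep j.rep.toFun) (c.base j.rep.pt)

/-- The change of natural coordinates of `J¹π` from `c` to `c'`. -/
def change1 (c' : AdaptedChart m n π) : V1 m n → V1 m n :=
  localExpr (c.jetDom 1 ∩ c'.jetDom 1) c.coord1 c'.coord1

end AdaptedChart

/-! ### Multimomentum bundles -/

variable (m n π) in
/-- A point of the bundle `Λ₂^m(J¹π)`: an `m`-covector at a point of `J¹π` that vanishes on any two
vertical vectors.  It is given by its local expressions in the natural charts of `J¹π` around the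
point, which are related by the derivatives of the coordinate changes. -/
structure Momentum where
  jet : Jet m n π 1
  form : AdaptedChart m n π → V1 m n [⋀^Fin m]→L[ℝ] ℝ
  form_of_notMem : ∀ c, jet ∉ c.jetDom 1 → form c = 0
  compat : ∀ c c', jet ∈ c.jetDom 1 → jet ∈ c'.jetDom 1 →
    form c = (form c').compContinuousLinearMap (fderiv ℝ (c.change1 c') (c.coord1 jet))
  vertical : ∀ c, VanishesOnTwoVertical (form c)

variable (m n π) in
/-- The extended 2-symmetric multimomentum bundle `J²π†`: the points of `Λ₂^m(J¹π)` with
`p^{ij}_α = p^{ji}_α`. -/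
def Dag := {ξ : Momentum m n π // ∀ c i j α, mom2 (ξ.form c) i j α = mom2 (ξ.form c) j i α}

variable (m n π) in
/-- Equality modulo `Λ₁^m(J¹π)`, the semibasic `m`-covectors. -/
def dagSetoid : Setoid (Dag m n π) where
  r ξ ξ' := ξ.1.jet = ξ'.1.jet ∧ ∀ c, IsSemibasic (ξ.1.form c - ξ'.1.form c)
  iseqv :=
    { refl := fun _ => ⟨rfl, fun _ _ _ _ => by simp⟩
      symm := fun h => ⟨h.1.symm, fun c v a ha => by
        have := h.2 c v a ha
        simp only [ContinuousAlternatingMap.sub_apply] at this ⊢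
        linarith⟩
      trans := fun h h' => ⟨h.1.trans h'.1, fun c v a ha => by
        have h1 := h.2 c v a ha
        have h2 := h'.2 c v a ha
        simp only [ContinuousAlternatingMap.sub_apply] at h1 h2 ⊢
        linarith⟩ }

variable (m n π) in
/-- The restricted 2-symmetric multimomentum bundle `J²π‡ = J²π† / Λ₁^m(J¹π)`. -/
def DDag := Quotient (dagSetoid m n π)

/-- The quotient map `μ : J²π† → J²π‡`. -/
def mu (ξ : Dag m n π) : DDag m n π := Quotient.mk (dagSetoid m n π) ξ

/-- The projection `J²π‡ → J¹π`. -/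
def DDag.jet (w : DDag m n π) : Jet m n π 1 :=
  Quotient.lift (s := dagSetoid m n π) (fun ξ => ξ.1.jet) (fun _ _ h => h.1) w

namespace AdaptedChart

variable (c : AdaptedChart m n π)

/-- Natural coordinates of `J²π†`. -/
def coordDag (ξ : Dag m n π) : VDag m n :=
  (c.coord1 ξ.1.jet, ⟨ξ.1.form c, ξ.1.vertical c, ξ.2 c⟩)

/-- Domain of the natural chart of `J²π‡`. -/
def ddagDom : Set (DDag m n π) := {w | w.jet ∈ c.jetDom 1}

/-- Natural coordinates `(x^i, u^α, u_i^α, p^i_α, p^I_α)` of `J²π‡`; the coordinates of a class do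
not depend on the representative, and `p^{ij}_α = p^{1_i+1_j}_α / n(ij)`, that is,
`p^I_α` is the sum of the `p^{ij}_α` over the pairs with `1_i + 1_j = I`. -/
def coordDDag (w : DDag m n π) : VDDag m n :=
  (c.coord1 w.jet,
    fun i α => mom1 ((Quotient.out w : Dag m n π).1.form c) i α,
    fun I α => ∑ i, ∑ j,
      if idx2 i j = I then mom2 ((Quotient.out w : Dag m n π).1.form c) i j α else 0)

end AdaptedChart

/-! ### Lagrangians, Legendre map -/

/-- Smoothness of a function on `J²π`. -/
def SmoothOnJet2 (L : Jet m n π 2 → ℝ) : Prop :=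
  ∀ c : AdaptedChart m n π, ∀ j ∈ c.jetDom 2,
    ContDiffAt ℝ ∞ (localExpr (c.jetDom 2) c.coord2 L) (c.coord2 j)

section Lagrangian

variable (η : VolumeForm m M) (L : Jet m n π 2 → ℝ)

/-- The function `L_c` with `ℒ = L η = L_c dx^1 ∧ … ∧ dx^m` in the natural chart of `J²π` induced by
`c`.  It is the local expression of `L` when `η = dx^1 ∧ … ∧ dx^m` in the chart. -/
def localLagrangian (c : AdaptedChart m n π) : V2 m n → ℝ :=
  localExpr (c.jetDom 2) c.coord2 (fun j => L j * c.volCoeff η j.base)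

/-- `∂L_c/∂u_i^α`. -/
def dLdU1 (c : AdaptedChart m n π) (i : Fin m) (α : Fin n) (z : V2 m n) : ℝ :=
  fderiv ℝ (localLagrangian η L c) z (dU1 i α, 0)

/-- `∂L_c/∂u_I^α`, `|I| = 2`. -/
def dLdU2 (c : AdaptedChart m n π) (I : Sym (Fin m) 2) (α : Fin n) (z : V2 m n) : ℝ :=
  fderiv ℝ (localLagrangian η L c) z (0, Pi.single I (e α))

/-- The coordinate total derivative
`d/dx^j = ∂/∂x^j + u_j^α ∂/∂u^α + u_{1_i+1_j}^α ∂/∂u_i^α + u_{I+1_j}^α ∂/∂u_I^α`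
of a function on the coordinates of second jets. -/
def totalDeriv (j : Fin m) (f : V2 m n → ℝ) (z : V3 m n) : ℝ :=
  fderiv ℝ f z.1 ((e j, z.1.1.2.2 j, fun i => z.1.2 (idx2 i j)), fun I => z.2 (j ::ₛ I))

/-- The coordinate expression of the restricted Legendre map in the natural charts induced
by `c`. -/
def legendreLocal (c : AdaptedChart m n π) (z : V3 m n) : VDDag m n :=
  (z.1.1,
    fun i α => dLdU1 η L c i α z.1 -
      ∑ j, (1 / nij i j) * totalDeriv j (dLdU2 η L c (idx2 i j) α) z,
    fun I α => dLdU2 η L c I α z.1)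

/-- The zero covector at a point of `J¹π`, as a point of `J²π†`. -/
def zeroDag (u : Jet m n π 1) : Dag m n π :=
  ⟨{ jet := u
     form := fun _ => 0
     form_of_notMem := fun _ _ => rfl
     compat := fun _ _ _ _ => by ext; simp
     vertical := fun _ _ _ _ _ _ _ => rfl }, fun _ _ _ _ => rfl⟩

open Classical in
/-- The restricted Legendre map `FL : J³π → J²π‡`: the bundle map over `J¹π` whose expression in all
natural charts is `legendreLocal`.  (These expressions agree on overlaps, so the first case always
holds.) -/
def legendre (j : Jet m n π 3) : DDag m n π :=
  if h : ∃ w : DDag m n π, w.jet = j.proj 1 (by norm_num) ∧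
      ∀ c : AdaptedChart m n π, j ∈ c.jetDom 3 → c.coordDDag w = legendreLocal η L c (c.coord3 j)
  then h.choose
  else mu (zeroDag (j.proj 1 (by norm_num)))

/-- Regularity: the rank of the Legendre map is `dim J²π‡` at every point of `J³π`. -/
def IsRegular : Prop :=
  ∀ c : AdaptedChart m n π, ∀ j ∈ c.jetDom 3,
    Module.finrank ℝ (LinearMap.range ((fderiv ℝ
      (localExpr (c.jetDom 3) c.coord3 (fun j' => c.coordDDag (legendre η L j')))
      (c.coord3 j) : V3 m n →L[ℝ] VDDag m n) : V3 m n →ₗ[ℝ] VDDag m n)) =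
    Module.finrank ℝ (VDDag m n)

/-- `Υ` is a (smooth) global section of the restricted Legendre map. -/
structure IsLegendreSection (Υ : DDag m n π → Jet m n π 3) : Prop where
  legendre_apply : ∀ w, legendre η L (Υ w) = w
  smooth : ∀ c : AdaptedChart m n π, ∀ w ∈ c.ddagDom,
    ContDiffAt ℝ ∞ (localExpr c.ddagDom c.coordDDag (fun w' => c.coord3 (Υ w'))) (c.coordDDag w)

/-- Hyperregularity: `ℒ = L η` is regular and its Legendre map has a global section. -/
def IsHyperregular : Prop := IsRegular η L ∧ ∃ Υ, IsLegendreSection η L Υ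

/-! ### The Hamiltonian section and the Hamilton–Cartan form -/

/-- The coefficient with respect to `dx^1 ∧ … ∧ dx^m` of the pairing
`𝒞ˢ(j²φ, ξ) = (j¹φ)^* ξ` in the chart `c`. -/
def pairing (c : AdaptedChart m n π) (j : Jet m n π 2) (ξ : Dag m n π) : ℝ :=
  ξ.1.form c
    (fun k => fderiv ℝ (prolong1 (c.localRep j.rep.toFun)) (c.base j.rep.pt) (e k))

/-- The Hamiltonian submanifold `𝒲_o` of `𝒲 = J³π ×_{J¹π} J²π†`, on which the coupling form
is equal to the Lagrangian density. -/
def hamiltonianSubmanifold : Set (Jet m n π 3 × Dag m n π) :=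
  {p | p.2.1.jet = p.1.proj 1 (by norm_num) ∧
    ∀ c : AdaptedChart m n π, p.1 ∈ c.jetDom 3 →
      pairing c (p.1.proj 2 (by norm_num)) p.2 =
        L (p.1.proj 2 (by norm_num)) * c.volCoeff η p.1.base}

open Classical in
/-- The Hamiltonian section `h : J²π‡ → J²π†` of `μ`: `h(w)` is the element `ξ` of the class `w`
with `(Υ(w), ξ) ∈ 𝒲_o`.  (There is exactly one if `Υ` is a section of the Legendre map, so the first
case holds.) -/
def hamiltonianSection (Υ : DDag m n π → Jet m n π 3) (w : DDag m n π) : Dag m n π :=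
  if h : ∃ ξ : Dag m n π, mu ξ = w ∧ (Υ w, ξ) ∈ hamiltonianSubmanifold η L then h.choose
  else Quotient.out w

/-- Local expression of the Hamiltonian section in the natural charts induced by `c`. -/
def hamiltonianLocal (Υ : DDag m n π → Jet m n π 3) (c : AdaptedChart m n π) :
    VDDag m n → VDag m n :=
  localExpr c.ddagDom c.coordDDag (fun w => c.coordDag (hamiltonianSection η L Υ w))

/-- The Hamilton–Cartan form `Ω_h = h^*Ω₁ˢ` on `J²π‡`, by its local expressions in the
natural charts. -/
def hamiltonCartan (Υ : DDag m n π → Jet m n π 3) (c : AdaptedChart m n π) (z : VDDag m n) :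
    VDDag m n [⋀^Fin (m + 1)]→L[ℝ] ℝ :=
  (liouvilleD m n (hamiltonianLocal η L Υ c z)).compContinuousLinearMap
    (fderiv ℝ (hamiltonianLocal η L Υ c) z)

end Lagrangian

/-- A smooth form of degree `k + 1` on `J²π‡`, given by its local expressions in the natural charts,
is multisymplectic if `k + 1` is at most the dimension, and it is closed and 1-nondegenerate
at every point. -/
def IsMultisymplectic {k : ℕ}
    (Ω : AdaptedChart m n π → VDDag m n → VDDag m n [⋀^Fin (k + 1)]→L[ℝ] ℝ) : Prop :=
  k + 1 ≤ Module.finrank ℝ (VDDag m n) ∧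
  ∀ c : AdaptedChart m n π, ∀ w ∈ c.ddagDom,
    ContDiffAt ℝ ∞ (Ω c) (c.coordDDag w) ∧
    extDeriv (Ω c) (c.coordDDag w) = 0 ∧
    ∀ Y : VDDag m n,
      (∀ v : Fin k → VDDag m n, Ω c (c.coordDDag w) (Fin.cons Y v) = 0) ↔ Y = 0

end Bundle

end SecondOrderField

end

noncomputable section

namespace SecondOrderField

/-! ### Alternating forms that vanish on two vertical vectors -/

section Algebra

variable {m n : ℕ}

/-! In natural coordinates the Hamiltonian section keeps `(x, u, u_i, p^i, p^I)` and adds one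
function `p`, the coefficient of `d^mx`. Pairing a covector with a prolonged section gives `p` plus
a term linear in the momenta (`pairing_eq`), so the condition that this equals the Lagrangian along
`Υ` has exactly one solution: `p` is the Lagrangian coefficient minus the momentum term, that is,
minus the Hamiltonian. It is smooth because `L`, `η` and `Υ` are (`contDiffAt_negHamiltonianLocal`).

The tautological form only sees the projection to first jets, which the section does not change.
Hence the pullback of the Liouville `m`-form is `cartanForm p`, and by naturality of `d` the
Hamilton–Cartan form is `-d (cartanForm p)` near each point (`hamiltonCartan_eventuallyEq`).
Smoothness is then clear, and closedness is `d² = 0`.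

Nondegeneracy holds for every smooth `p` (`cartanForm_nondegenerate`). Contracting `d (cartanForm
p)` with `Y` and with pure momentum directions shows that all covectors with arbitrary momenta
vanish on tuples containing the first-jet part of `Y`. With `m ≥ 2` and `n ≥ 1` there are enough of
them to force that part to be zero. What remains of the contraction is the covector whose
coefficients are `dp(Y)` and the momentum part of `Y`, and a covector determines its coefficients.

The rest of the work ties these coordinates to the intrinsic bundles: jet equality can be tested in
one chart, the derivative of a prolonged coordinate change preserves semibasic and 2-symmetric
covectors, and both sides of the equation for `p` scale by the same Jacobian determinant, so solving
it in one chart solves it in all. -/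

/-- The determinant on the base coordinates, as an alternating form. -/
def detX (m : ℕ) : X m [⋀^Fin m]→ₗ[ℝ] ℝ := (EuclideanSpace.basisFun (Fin m) ℝ).toBasis.det

theorem basisFun_toBasis (k : ℕ) :
    ⇑(EuclideanSpace.basisFun (Fin k) ℝ).toBasis = fun i => e i := by
  ext1 i; simp [e]

theorem detX_e : detX m (fun k => e k) = 1 := by
  rw [← basisFun_toBasis]
  exact (EuclideanSpace.basisFun (Fin m) ℝ).toBasis.det_self

theorem sum_smul_e {k : ℕ} (x : EuclideanSpace ℝ (Fin k)) : ∑ i, x i • (e i) = x := by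
  have := (EuclideanSpace.basisFun (Fin k) ℝ).toBasis.sum_repr x
  simpa [e] using this

theorem e_apply {k : ℕ} (i j : Fin k) : (e i : EuclideanSpace ℝ (Fin k)) j = if j = i then 1 else 0 := by
  simp [e]

/-- An alternating `m`-form on the base coordinates is a multiple of the determinant. -/
theorem alternating_eq_detX (f : X m [⋀^Fin m]→ₗ[ℝ] ℝ) (v : Fin m → X m) :
    f v = f (fun k => e k) * detX m v := by
  have h := f.eq_smul_basis_det (EuclideanSpace.basisFun (Fin m) ℝ).toBasis
  rw [basisFun_toBasis] at h
  conv_lhs => rw [h]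
  rfl

/-- The pullback of a top-degree form by `J` is a multiple of the form itself; the factor is the
determinant of `J`. -/
theorem detX_map (J : X m →ₗ[ℝ] X m) (v : Fin m → X m) :
    detX m (fun k => J (v k)) = detX m (fun k => J (e k)) * detX m v := by
  simpa using alternating_eq_detX ((detX m).compLinearMap J) v

/-- Cramer's rule: after expanding `x` in the basis, every term other than the `i`-th repeats a
basis vector. -/
theorem detX_update (i : Fin m) (x : X m) :
    detX m (Function.update (fun k => e k) i x) = x i := by
  conv_lhs => rw [← sum_smul_e x]
  rw [AlternatingMap.map_update_sum]
  rw [Finset.sum_eq_single i]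
  · rw [AlternatingMap.map_update_smul, Function.update_eq_self, detX_e]; simp
  · intro j _ hj
    rw [AlternatingMap.map_update_smul]
    rw [AlternatingMap.map_update_self _ _ (Ne.symm hj)]
    simp
  · simp

/-- The projection of first jets to the base, as a linear map. -/
def prX (m n : ℕ) : V1 m n →ₗ[ℝ] X m := LinearMap.fst ℝ _ _

/-- The form `(v_1, …, v_m) ↦ ∑ₐ det (x_1, …, T v_a, …, x_m)`, `x_k` the base part of `v_k`. -/
def insertForm (T : V1 m n →ₗ[ℝ] X m) : V1 m n [⋀^Fin m]→ₗ[ℝ] ℝ where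
  toMultilinearMap := ∑ a, (detX m).toMultilinearMap.compLinearMap
    (fun k => if k = a then T else prX m n)
  map_eq_zero_of_eq' := by
    intro v b c hv hbc
    have key : ∀ a, (fun k => (if k = a then T else prX m n) (v k)) =
        Function.update (fun k => (v k).1) a (T (v a)) := by
      intro a; ext1 k
      by_cases h : k = a
      · subst h; simp
      · simp [h, prX]
    simp only [MultilinearMap.toFun_eq_coe, _root_.sum_apply,
      MultilinearMap.compLinearMap_apply, AlternatingMap.coe_multilinearMap, key]
    -- If the `b`-th and `c`-th arguments agree, every summand with `T` in another slot has a
    -- repeated entry. The two remaining summands differ by the transposition of `b` and `c`, so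
    -- they cancel.
    rw [Fintype.sum_eq_add b c hbc]
    · have : Function.update (fun k => (v k).1) c (T (v c)) =
          Function.update (fun k => (v k).1) b (T (v b)) ∘ Equiv.swap b c := by
        ext1 k
        simp only [Function.comp_apply]
        by_cases hb : k = b
        · subst hb; rw [Equiv.swap_apply_left, Function.update_of_ne hbc, Function.update_of_ne hbc.symm, hv]
        · by_cases hc : k = c
          · subst hc; simp [hv]
          · rw [Equiv.swap_apply_of_ne_of_ne hb hc]; simp [hb, hc]
      rw [this, AlternatingMap.map_swap _ _ hbc]; simp
    · rintro a ⟨hb, hc⟩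
      exact (detX m).map_eq_zero_of_eq _ (by simp [Ne.symm hb, Ne.symm hc, hv]) hbc

theorem insertForm_apply (T : V1 m n →ₗ[ℝ] X m) (v : Fin m → V1 m n) :
    insertForm T v = ∑ a, detX m (Function.update (fun k => (v k).1) a (T (v a))) := by
  have key : ∀ a, (fun k => (if k = a then T else prX m n) (v k)) =
      Function.update (fun k => (v k).1) a (T (v a)) := by
    intro a; ext1 k
    by_cases h : k = a
    · subst h; simp
    · simp [h, prX]
  simp only [← key]
  change (∑ a, (detX m).toMultilinearMap.compLinearMap
    (fun k => if k = a then T else prX m n)) v = _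
  simp

/-- The endomorphism part `du^α, du^α_i ↦ ∂/∂x^i` of the covector with given momenta. -/
def momMap (P : (Fin m → Fin n → ℝ) × (Sym (Fin m) 2 → Fin n → ℝ)) : V1 m n →ₗ[ℝ] X m where
  toFun y := WithLp.toLp 2 fun j => (∑ α, P.1 j α * y.2.1 α) +
    ∑ i, ∑ α, (1 / nij i j * P.2 (idx2 i j) α) * y.2.2 i α
  map_add' y y' := by
    ext j
    simp [mul_add, Finset.sum_add_distrib]; ring
  map_smul' c y := by
    ext j
    simp [mul_add, Finset.mul_sum]
    congr 1
    · exact Finset.sum_congr rfl fun _ _ => by ring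
    · exact Finset.sum_congr rfl fun _ _ => Finset.sum_congr rfl fun _ _ => by ring

theorem momMap_apply (P : (Fin m → Fin n → ℝ) × (Sym (Fin m) 2 → Fin n → ℝ)) (y : V1 m n)
    (j : Fin m) : momMap P y j = (∑ α, P.1 j α * y.2.1 α) +
    ∑ i, ∑ α, (1 / nij i j * P.2 (idx2 i j) α) * y.2.2 i α := rfl

theorem nij_comm (i j : Fin m) : nij i j = nij j i := by simp [nij, eq_comm]

theorem nij_ne_zero (i j : Fin m) : nij i j ≠ 0 := by unfold nij; split_ifs <;> norm_num

theorem idx2_comm (i j : Fin m) : idx2 i j = idx2 j i := Sym.cons_swap _ _ _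

theorem idx2_eq_iff (i j k l : Fin m) :
    idx2 i j = idx2 k l ↔ (i = k ∧ j = l) ∨ (i = l ∧ j = k) := by
  unfold idx2
  rw [← Sym.coe_inj]
  simp only [Sym.coe_cons, Sym.coe_nil]
  rw [Multiset.cons_eq_cons]
  constructor
  · rintro (⟨h, h'⟩ | ⟨h, s, h1, h2⟩)
    · simp at h'; exact Or.inl ⟨h, h'⟩
    · have : s = 0 := by
        have := congrArg Multiset.card h1; simpa using this.symm
      subst this; simp at h1 h2; exact Or.inr ⟨h2.symm, h1⟩
  · rintro (⟨rfl, rfl⟩ | ⟨rfl, rfl⟩)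
    · simp
    · by_cases h : i = j
      · simp [h]
      · right; exact ⟨h, 0, by simp⟩

theorem exists_idx2 (I : Sym (Fin m) 2) : ∃ i j, I = idx2 i j := by
  obtain ⟨i, s, rfl⟩ := Sym.exists_eq_cons_of_succ I
  obtain ⟨j, t, rfl⟩ := Sym.exists_eq_cons_of_succ s
  exact ⟨i, j, by rw [idx2, Subsingleton.elim t Sym.nil]⟩

/-- The multi-index `1_i + 1_j` comes from `n(ij)` ordered pairs. This is why the normalisation
`p^{ij} = p^I / n(ij)` is inverse to summing the `p^{ij}` over the pairs giving `I`. -/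
theorem sum_idx2 (f : Fin m → Fin m → ℝ) (hf : ∀ i j, f i j = f j i) (i j : Fin m) :
    (∑ k, ∑ l, if idx2 k l = idx2 i j then f k l else 0) = nij i j * f i j := by
  simp only [idx2_eq_iff]
  by_cases h : i = j
  · subst h
    rw [Finset.sum_eq_single i]
    · rw [Finset.sum_eq_single i]
      · simp [nij]
      · intro l _ hl; simp [hl]
      · simp
    · intro k _ hk; simp [hk]
    · simp
  · rw [Fintype.sum_eq_add i j h]
    · rw [Finset.sum_eq_single j, Finset.sum_eq_single i]
      · simp [nij, h, hf j i]; ring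
      · intro l _ hl; simp [hl, Ne.symm h]
      · simp
      · intro l _ hl; simp [hl, h]
      · simp
    · rintro k ⟨hk, hk'⟩; simp [hk, hk']

theorem continuous_detX : Continuous (detX m) := by
  have : ⇑(detX m) = fun v => Matrix.det (Matrix.of fun i j => v j i) := by
    ext1 v
    simp only [detX, Module.Basis.det_apply]
    rfl
  rw [this]
  refine Continuous.matrix_det (continuous_matrix fun i j => ?_)
  exact (EuclideanSpace.proj i : X m →L[ℝ] ℝ).continuous.comp (continuous_apply j)

theorem continuous_insertForm (T : V1 m n →ₗ[ℝ] X m) : Continuous (insertForm T) := by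
  rw [funext (insertForm_apply T)]
  refine continuous_finsetSum _ fun a _ => continuous_detX.comp (Continuous.update ?_ a ?_)
  · exact continuous_pi fun k => continuous_fst.comp (continuous_apply k)
  · exact T.continuous_of_finiteDimensional.comp (continuous_apply a)

/-- The covector `p d^mx + …` with given coefficients, as a linear form. -/
def covector (q : ℝ × (Fin m → Fin n → ℝ) × (Sym (Fin m) 2 → Fin n → ℝ)) :
    V1 m n [⋀^Fin m]→L[ℝ] ℝ :=
  { q.1 • (detX m).compLinearMap (prX m n) + insertForm (momMap q.2) with
    cont := by
      refine (Continuous.const_smul (continuous_detX.comp ?_) q.1).add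
        (continuous_insertForm (momMap q.2))
      exact continuous_pi fun k => continuous_fst.comp (continuous_apply k) }

theorem covector_apply (q : ℝ × (Fin m → Fin n → ℝ) × (Sym (Fin m) 2 → Fin n → ℝ))
    (v : Fin m → V1 m n) : covector q v = q.1 * detX m (fun k => (v k).1) +
      ∑ a, detX m (Function.update (fun k => (v k).1) a (momMap q.2 (v a))) := by
  rw [← insertForm_apply]; rfl

theorem covector_vertical (q : ℝ × (Fin m → Fin n → ℝ) × (Sym (Fin m) 2 → Fin n → ℝ)) :
    VanishesOnTwoVertical (covector q) := by
  intro v a b hab ha hb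
  rw [covector_apply, (detX m).map_coord_zero a ha, mul_zero, zero_add]
  refine Finset.sum_eq_zero fun c _ => ?_
  by_cases h : c = a
  · exact (detX m).map_coord_zero b (by subst h; simp [Ne.symm hab, hb])
  · exact (detX m).map_coord_zero a (by simp [Ne.symm h, ha])

theorem update_fst (v : Fin m → V1 m n) (a : Fin m) (y : V1 m n) :
    (fun k => (Function.update v a y k).1) = Function.update (fun k => (v k).1) a y.1 := by
  ext1 k
  by_cases h : k = a
  · subst h; simp
  · simp [h]

theorem momMap_horizontal (P : (Fin m → Fin n → ℝ) × (Sym (Fin m) 2 → Fin n → ℝ)) (x : X m) :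
    momMap P ((x, 0, 0) : V1 m n) = 0 := by
  ext j; simp [momMap_apply]

/-- The value of a covector when a vertical vector is inserted into a horizontal frame. -/
theorem covector_update (q : ℝ × (Fin m → Fin n → ℝ) × (Sym (Fin m) 2 → Fin n → ℝ))
    (v : Fin m → V1 m n) (a : Fin m) (y : V1 m n) (hy : y.1 = 0) :
    covector q (Function.update v a y) =
      detX m (Function.update (fun k => (v k).1) a (momMap q.2 y)) := by
  rw [covector_apply, update_fst, hy, Finset.sum_eq_single a, (detX m).map_coord_zero a (by simp)]
  · simp
  · intro b _ hb
    exact (detX m).map_coord_zero a (by simp [Ne.symm hb])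
  · simp

/-- On a frame lifting the base frame a covector is `p` plus a trace of its momentum map. The
derivative of a prolonged section is such a frame. -/
theorem covector_frame (q : ℝ × (Fin m → Fin n → ℝ) × (Sym (Fin m) 2 → Fin n → ℝ))
    (v : Fin m → V1 m n) (hv : ∀ k, (v k).1 = e k) :
    covector q v = q.1 + ∑ a, momMap q.2 (v a) a := by
  have : (fun k => (v k).1) = fun k => e k := funext hv
  rw [covector_apply, this, detX_e, mul_one]
  simp only [detX_update]

theorem mom1_covector (q : ℝ × (Fin m → Fin n → ℝ) × (Sym (Fin m) 2 → Fin n → ℝ)) (i : Fin m)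
    (α : Fin n) : mom1 (covector q) i α = q.2.1 i α := by
  rw [mom1, covector_update _ _ _ _ rfl]
  refine (detX_update _ _).trans ?_
  simp [momMap_apply, dU, e_apply]

theorem mom2_covector (q : ℝ × (Fin m → Fin n → ℝ) × (Sym (Fin m) 2 → Fin n → ℝ)) (i j : Fin m)
    (α : Fin n) : mom2 (covector q) i j α = 1 / nij i j * q.2.2 (idx2 i j) α := by
  rw [mom2, covector_update _ _ _ _ rfl]
  refine (detX_update _ _).trans ?_
  rw [momMap_apply, Finset.sum_eq_single i]
  · simp [dU1, e_apply]
  · intro k _ hk; simp [dU1, hk]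
  · simp [dU1]

theorem covector_dX (q : ℝ × (Fin m → Fin n → ℝ) × (Sym (Fin m) 2 → Fin n → ℝ)) :
    covector q (fun k => dX k) = q.1 := by
  rw [covector_frame _ _ fun k => rfl]
  simp [dX, momMap_horizontal]

theorem covector_mem (q : ℝ × (Fin m → Fin n → ℝ) × (Sym (Fin m) 2 → Fin n → ℝ)) :
    covector q ∈ SymMom m n := by
  refine ⟨covector_vertical q, fun i j α => ?_⟩
  rw [mom2_covector, mom2_covector, nij_comm, idx2_comm]

theorem mom2_sum_covector (q : ℝ × (Fin m → Fin n → ℝ) × (Sym (Fin m) 2 → Fin n → ℝ))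
    (I : Sym (Fin m) 2) (α : Fin n) :
    (∑ i, ∑ j, if idx2 i j = I then mom2 (covector q) i j α else 0) = q.2.2 I α := by
  obtain ⟨i, j, rfl⟩ := exists_idx2 I
  rw [sum_idx2 (fun i j => mom2 (covector q) i j α) fun i j => (covector_mem q).2 i j α]
  rw [mom2_covector, one_div, mul_inv_cancel_left₀ (nij_ne_zero i j)]

theorem covector_add (q q' : ℝ × (Fin m → Fin n → ℝ) × (Sym (Fin m) 2 → Fin n → ℝ)) :
    covector (q + q') = covector q + covector q' := by
  have h : momMap (q + q').2 = momMap q.2 + momMap q'.2 := by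
    refine LinearMap.ext fun y => ?_
    ext j
    simp [momMap_apply, add_mul, mul_add, Finset.sum_add_distrib]
    ring
  ext v
  simp only [ContinuousAlternatingMap.add_apply, covector_apply, h, LinearMap.add_apply,
    AlternatingMap.map_update_add, Finset.sum_add_distrib, Prod.fst_add]
  ring

theorem covector_smul (c : ℝ) (q : ℝ × (Fin m → Fin n → ℝ) × (Sym (Fin m) 2 → Fin n → ℝ)) :
    covector (c • q) = c • covector q := by
  have h : momMap (c • q).2 = c • momMap q.2 := by
    refine LinearMap.ext fun y => ?_
    ext j
    simp only [momMap_apply, Prod.smul_snd, Prod.smul_fst, Pi.smul_apply, smul_eq_mul,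
      LinearMap.smul_apply, PiLp.smul_apply, mul_add, Finset.mul_sum]
    congr 1
    · exact Finset.sum_congr rfl fun _ _ => by ring
    · exact Finset.sum_congr rfl fun _ _ => Finset.sum_congr rfl fun _ _ => by ring
  ext v
  simp only [ContinuousAlternatingMap.smul_apply, covector_apply, h, LinearMap.smul_apply,
    AlternatingMap.map_update_smul, Prod.smul_fst, smul_eq_mul, mul_add, Finset.mul_sum, mul_assoc]

/-- The space of symmetric momenta in its linear coordinates. -/
def covectorCLM (m n : ℕ) :
    ℝ × (Fin m → Fin n → ℝ) × (Sym (Fin m) 2 → Fin n → ℝ) →L[ℝ] SymMom m n :=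
  LinearMap.toContinuousLinearMap
    { toFun := fun q => ⟨covector q, covector_mem q⟩
      map_add' := fun q q' => Subtype.ext (covector_add q q')
      map_smul' := fun c q => Subtype.ext (covector_smul c q) }

theorem covectorCLM_coe (q : ℝ × (Fin m → Fin n → ℝ) × (Sym (Fin m) 2 → Fin n → ℝ)) :
    (covectorCLM m n q : V1 m n [⋀^Fin m]→L[ℝ] ℝ) = covector q := rfl

/-- The standard basis of the coordinate space of first jets. -/
abbrev V1Basis (m n : ℕ) : Module.Basis (Fin m ⊕ Fin n ⊕ (Σ _ : Fin m, Fin n)) ℝ (V1 m n) :=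
  (EuclideanSpace.basisFun (Fin m) ℝ).toBasis.prod
    ((EuclideanSpace.basisFun (Fin n) ℝ).toBasis.prod
      (Pi.basis fun _ : Fin m => (EuclideanSpace.basisFun (Fin n) ℝ).toBasis))

theorem V1Basis_inl (i : Fin m) : V1Basis m n (Sum.inl i) = dX i := by
  simp [V1Basis, dX, e, Module.Basis.prod_apply]; rfl

theorem V1Basis_inr_inl (α : Fin n) : V1Basis m n (Sum.inr (Sum.inl α)) = dU α := by
  simp [V1Basis, dU, e, Module.Basis.prod_apply]

theorem V1Basis_inr_inr (p : Σ _ : Fin m, Fin n) :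
    V1Basis m n (Sum.inr (Sum.inr p)) = dU1 p.1 p.2 := by
  simp [V1Basis, dU1, e, Module.Basis.prod_apply, Pi.basis_apply]

/-- Away from `a` the map takes too few values to be onto; sending `a` to a missed value makes it
injective, hence a permutation. It serves to reorder a basis tuple with a single vertical entry. -/
theorem exists_perm_update {ι : Type*} [Fintype ι] [DecidableEq ι] (a : ι) (s : ι → ι)
    (hs : ∀ k l, k ≠ a → l ≠ a → s k = s l → k = l) :
    ∃ σ : Equiv.Perm ι, ∀ k ≠ a, σ k = s k := by
  have hcard : ((Finset.univ.erase a).image s).card < (Finset.univ : Finset ι).card :=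
    Finset.card_image_le.trans_lt (Finset.card_erase_lt_of_mem (Finset.mem_univ a))
  obtain ⟨i, -, hi⟩ := Finset.exists_mem_notMem_of_card_lt_card hcard
  have hi' : ∀ k ≠ a, s k ≠ i := fun k hk h =>
    hi (Finset.mem_image.2 ⟨k, by simp [hk], h⟩)
  have hinj : Function.Injective (Function.update s a i) := by
    intro k l h
    by_cases hk : k = a <;> by_cases hl : l = a
    · rw [hk, hl]
    · subst hk; simp [hl] at h; exact absurd h.symm (hi' l hl)
    · subst hl; simp [hk] at h; exact absurd h (hi' k hk)
    · simp [hk, hl] at h; exact hs k l hk hl h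
  exact ⟨Equiv.ofBijective _ (Finite.injective_iff_bijective.1 hinj), fun k hk => by simp [hk]⟩

/-- A covector that vanishes on two vertical vectors is determined by its coefficients. -/
theorem eq_zero_of_coeff {ξ : V1 m n [⋀^Fin m]→L[ℝ] ℝ} (h : VanishesOnTwoVertical ξ)
    (h0 : ξ (fun k => dX k) = 0) (h1 : ∀ i α, mom1 ξ i α = 0) (h2 : ∀ i j α, mom2 ξ i j α = 0) :
    ξ = 0 := by
  apply ContinuousAlternatingMap.toAlternatingMap_injective
  -- It suffices to test on tuples of distinct basis vectors, sorted by the number of vertical ones.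
  -- With none, the tuple is a permutation of the frame `dX`; with one, a permutation of a tuple
  -- defining a momentum; with two or more, the form vanishes by hypothesis.
  refine Module.Basis.ext_alternating (V1Basis m n) fun v hv => ?_
  simp only [ContinuousAlternatingMap.coe_toAlternatingMap, ContinuousAlternatingMap.toAlternatingMap_zero, AlternatingMap.zero_apply]
  have hvert : ∀ a, (V1Basis m n (Sum.inr a)).1 = 0 := by
    rintro (α | p)
    · rw [V1Basis_inr_inl]; rfl
    · rw [V1Basis_inr_inr]; rfl
  by_cases hall : ∀ k, ∃ i, v k = Sum.inl i
  · choose s hs using hall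
    have hinj : Function.Injective s := fun k l hkl => hv (by rw [hs, hs, hkl])
    set σ := Equiv.ofBijective s (Finite.injective_iff_bijective.1 hinj)
    have : (fun i => V1Basis m n (v i)) = (fun k => dX k) ∘ σ := by
      ext1 k; simp only [hs k, V1Basis_inl, Function.comp_apply]; rfl
    rw [this]
    have := ξ.toAlternatingMap.map_perm (fun k => dX k) σ
    rw [ContinuousAlternatingMap.coe_toAlternatingMap, h0, smul_zero] at this
    exact this
  · push Not at hall
    obtain ⟨a, ha⟩ := hall
    obtain ⟨t, ht⟩ : ∃ t, v a = Sum.inr t := by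
      rcases hva : v a with i | t
      · exact absurd hva (ha i)
      · exact ⟨t, rfl⟩
    by_cases hb : ∃ b ≠ a, ∃ t', v b = Sum.inr t'
    · obtain ⟨b, hba, t', ht'⟩ := hb
      exact h _ a b hba.symm (by simp only [ht, hvert]) (by simp only [ht', hvert])
    · push Not at hb
      have hb' : ∀ k, ∃ i, k ≠ a → v k = Sum.inl i := by
        intro k
        rcases hvk : v k with i | t'
        · exact ⟨i, fun _ => rfl⟩
        · exact ⟨a, fun hk => absurd hvk (hb k hk t')⟩
      choose s hs using hb'
      obtain ⟨σ, hσ⟩ := exists_perm_update a s fun k l hk hl hkl =>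
        hv (by rw [hs k hk, hs l hl, hkl])
      have : (fun i => V1Basis m n (v i)) =
          Function.update (fun k => dX k) (σ a) (V1Basis m n (Sum.inr t)) ∘ σ := by
        ext1 k
        by_cases hk : k = a
        · subst hk; simp [ht]
        · simp only [hs k hk, V1Basis_inl, Function.comp_apply]
          rw [Function.update_of_ne (by simpa using hk), hσ k hk]
      rw [this]
      have h3 : ξ (Function.update (fun k => dX k) (σ a) (V1Basis m n (Sum.inr t))) = 0 := by
        rcases t with α | p
        · rw [V1Basis_inr_inl]; exact h1 _ _
        · rw [V1Basis_inr_inr]; exact h2 _ _ _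
      have := ξ.toAlternatingMap.map_perm
        (Function.update (fun k => dX k) (σ a) (V1Basis m n (Sum.inr t))) σ
      rw [ContinuousAlternatingMap.coe_toAlternatingMap, h3, smul_zero] at this
      exact this

/-- The linear coordinates of a symmetric momentum. -/
def coeffs (ξ : V1 m n [⋀^Fin m]→L[ℝ] ℝ) :
    ℝ × (Fin m → Fin n → ℝ) × (Sym (Fin m) 2 → Fin n → ℝ) :=
  (ξ fun k => dX k, mom1 ξ, fun I α => ∑ i, ∑ j, if idx2 i j = I then mom2 ξ i j α else 0)

theorem VanishesOnTwoVertical.sub {ξ ξ' : V1 m n [⋀^Fin m]→L[ℝ] ℝ} (h : VanishesOnTwoVertical ξ)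
    (h' : VanishesOnTwoVertical ξ') : VanishesOnTwoVertical (ξ - ξ') := by
  intro v a b hab ha hb
  simp [h v a b hab ha hb, h' v a b hab ha hb]

/-- Both sides vanish on two vertical vectors and have equal coefficients. Symmetry of `mom2` is
what allows the second-order coefficients to be recovered from their sums over ordered pairs. -/
theorem covector_coeffs {ξ : V1 m n [⋀^Fin m]→L[ℝ] ℝ} (h : ξ ∈ SymMom m n) :
    covector (coeffs ξ) = ξ := by
  rw [← sub_eq_zero]
  refine eq_zero_of_coeff ((covector_vertical _).sub h.1) ?_ ?_ ?_
  · simp [covector_dX, coeffs]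
  · intro i α
    have := mom1_covector (coeffs ξ) i α
    simp only [mom1, ContinuousAlternatingMap.sub_apply, coeffs] at this ⊢
    rw [this, sub_self]
  · intro i j α
    have := mom2_covector (coeffs ξ) i j α
    simp only [coeffs, sum_idx2 (fun i j => mom2 ξ i j α) fun i j => h.2 i j α] at this
    rw [one_div, inv_mul_cancel_left₀ (nij_ne_zero i j)] at this
    simp only [mom2, ContinuousAlternatingMap.sub_apply, coeffs] at this ⊢
    rw [this, sub_self]

theorem coeffs_covector (q : ℝ × (Fin m → Fin n → ℝ) × (Sym (Fin m) 2 → Fin n → ℝ)) :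
    coeffs (covector q) = q := by
  refine Prod.ext (covector_dX q) (Prod.ext ?_ ?_)
  · ext i α; exact mom1_covector q i α
  · ext I α; exact mom2_sum_covector q I α

theorem isSemibasic_covector (p : ℝ) : IsSemibasic (covector (m := m) (n := n) (p, 0)) := by
  intro v a ha
  have : momMap (m := m) (n := n) 0 = 0 := by
    refine LinearMap.ext fun y => ?_
    ext j; simp [momMap_apply]
  rw [covector_apply, (detX m).map_coord_zero a ha]
  simp only [mul_zero, zero_add, this, LinearMap.zero_apply]
  exact Finset.sum_eq_zero fun b _ => (detX m).map_coord_zero b (by simp)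

/-- Symmetric momenta with equal coefficients of positive degree differ by a semibasic form. -/
theorem isSemibasic_sub_iff {ξ ξ' : V1 m n [⋀^Fin m]→L[ℝ] ℝ} (h : ξ ∈ SymMom m n)
    (h' : ξ' ∈ SymMom m n) : IsSemibasic (ξ - ξ') ↔ (coeffs ξ).2 = (coeffs ξ').2 := by
  constructor
  · intro hs
    have h1 : mom1 ξ = mom1 ξ' := by
      ext i α
      have := hs (Function.update (fun k => dX k) i (dU α)) i (by simp [dU])
      exact sub_eq_zero.1 this
    have h2 : mom2 ξ = mom2 ξ' := by
      ext i j α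
      have := hs (Function.update (fun k => dX k) j (dU1 i α)) j (by simp [dU1])
      exact sub_eq_zero.1 this
    simp only [coeffs, h1, h2]
  · intro hc
    -- By linearity the difference has zero momenta, so only its `d^mx` term is left.
    have : ξ - ξ' = covector ((coeffs ξ).1 - (coeffs ξ').1, 0) := by
      conv_lhs => rw [← covector_coeffs h, ← covector_coeffs h']
      rw [sub_eq_iff_eq_add, ← covector_add]
      congr 1
      exact Prod.ext (by simp) (by simp [hc])
    rw [this]
    exact isSemibasic_covector _

end Algebra

/-! ### Covectors under prolonged changes of coordinates -/

section Transformation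

variable {m n : ℕ}

/-- The linear structure of the derivative of a prolonged change of adapted coordinates. -/
structure IsProlonged (A : V1 m n →L[ℝ] V1 m n) (J K : X m →ₗ[ℝ] X m) (B : U n →ₗ[ℝ] U n) :
    Prop where
  base : ∀ v, (A v).1 = J v.1
  jet : ∀ w : Fin m → U n, A (0, 0, w) = (0, 0, fun k => B (∑ i, (K (e k)) i • w i))
  inv : ∀ x, J (K x) = x

theorem IsProlonged.isSemibasic {A : V1 m n →L[ℝ] V1 m n} {J K : X m →ₗ[ℝ] X m}
    {B : U n →ₗ[ℝ] U n} (hA : IsProlonged A J K B) {ξ : V1 m n [⋀^Fin m]→L[ℝ] ℝ}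
    (h : IsSemibasic ξ) : IsSemibasic (ξ.compContinuousLinearMap A) := fun v a ha =>
  h _ a (by simp [hA.base, ha])

theorem IsProlonged.vanishesOnTwoVertical {A : V1 m n →L[ℝ] V1 m n} {J K : X m →ₗ[ℝ] X m}
    {B : U n →ₗ[ℝ] U n} (hA : IsProlonged A J K B) {ξ : V1 m n [⋀^Fin m]→L[ℝ] ℝ}
    (h : VanishesOnTwoVertical ξ) : VanishesOnTwoVertical (ξ.compContinuousLinearMap A) :=
  fun v a b hab ha hb => h _ a b hab (by simp [hA.base, ha]) (by simp [hA.base, hb])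

/-- The symmetry of the second order momenta is preserved by changes of adapted coordinates. -/
theorem IsProlonged.mem_symMom {A : V1 m n →L[ℝ] V1 m n} {J K : X m →ₗ[ℝ] X m}
    {B : U n →ₗ[ℝ] U n} (hA : IsProlonged A J K B) {ξ : V1 m n [⋀^Fin m]→L[ℝ] ℝ}
    (h : ξ ∈ SymMom m n) : ξ.compContinuousLinearMap A ∈ SymMom m n := by
  refine ⟨hA.vanishesOnTwoVertical h.1, ?_⟩
  obtain ⟨q, rfl⟩ : ∃ q, covector q = ξ := ⟨_, covector_coeffs h⟩
  -- Second-order momenta transform by a congruence: both indices are contracted with the same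
  -- matrix of `K`, up to the factor `det J`. The result is symmetric in `i, j` as the original one
  -- is in `k, l`.
  have key : ∀ i j α, mom2 ((covector q).compContinuousLinearMap A) i j α =
      detX m (fun k => J (e k)) * ∑ l, ∑ k, ∑ β,
        (K (e l)) j * ((K (e k)) i * ((1 / nij k l * q.2.2 (idx2 k l) β) * (B (e α)) β)) := by
    intro i j α
    have h1 : A ∘ Function.update (fun k => dX k) j (dU1 i α) =
        Function.update (fun k => A (dX k)) j (A (dU1 i α)) := by
      rw [Function.comp_update]; rfl
    have h2 : A (dU1 i α) = (0, 0, fun k => (K (e k)) i • B (e α)) := by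
      rw [dU1, hA.jet]
      congr 2
      ext1 k
      rw [Finset.sum_eq_single i]
      · simp
      · intro l _ hl; simp [hl]
      · simp
    rw [mom2, ContinuousAlternatingMap.compContinuousLinearMap_apply, h1, h2,
      covector_update _ _ _ _ rfl]
    have h3 : (fun k => (A (dX k)).1) = fun k => J (e k) := funext fun k => hA.base _
    -- Writing the inserted vector as `J (K _)` puts every column in the image of `J`, so its
    -- determinant factors out.
    rw [h3, ← hA.inv (momMap q.2 _)]
    have h4 : ∀ x, Function.update (fun k => J (e k)) j (J x) =
        fun k => J (Function.update (fun k => e k) j x k) := by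
      intro x; ext1 k
      by_cases hk : k = j
      · subst hk; simp
      · simp [hk]
    rw [h4, detX_map, detX_update]
    congr 1
    conv_lhs => rw [← sum_smul_e (momMap q.2 _), map_sum]
    simp only [map_smul, WithLp.ofLp_sum, WithLp.ofLp_smul, Finset.sum_apply, Pi.smul_apply,
      smul_eq_mul]
    refine Finset.sum_congr rfl fun l _ => ?_
    rw [momMap_apply]
    simp only [Pi.zero_apply, WithLp.ofLp_zero, mul_zero, Finset.sum_const_zero, zero_add,
      Finset.sum_mul, WithLp.ofLp_smul, Pi.smul_apply, smul_eq_mul]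
    exact Finset.sum_congr rfl fun k _ => Finset.sum_congr rfl fun β _ => by ring
  intro i j α
  rw [key, key, Finset.sum_comm]
  congr 1
  refine Finset.sum_congr rfl fun l _ => Finset.sum_congr rfl fun k _ =>
    Finset.sum_congr rfl fun β _ => ?_
  rw [nij_comm, idx2_comm]; ring

theorem alternating_comp_detX (ξ : V1 m n [⋀^Fin m]→L[ℝ] ℝ) (D : X m →L[ℝ] V1 m n)
    (J : X m →ₗ[ℝ] X m) :
    ξ (fun k => D (J (e k))) = detX m (fun k => J (e k)) * ξ (fun k => D (e k)) := by
  rw [mul_comm]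
  exact alternating_eq_detX (ξ.toAlternatingMap.compLinearMap (D : X m →ₗ[ℝ] V1 m n))
    fun k => J (e k)

end Transformation

/-! ### Nondegeneracy -/

section Nondegenerate

variable {m n : ℕ}

/-- The constants `c` play no role, because each test tuple contains a vertical vector, which kills
the `d^mx` term. Placing a vertical vector in one slot and `y` in another reads off the base
components of `y`. Once `y` is itself vertical, inserting it alone gives `momMap P y = 0`, and
suitable `P` isolate its remaining components. -/
theorem eq_zero_of_covector_eq_zero (hm : 2 ≤ m) (hn : 1 ≤ n) {y : V1 m n}
    (h : ∀ P : (Fin m → Fin n → ℝ) × (Sym (Fin m) 2 → Fin n → ℝ), ∃ c : ℝ,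
      ∀ v : Fin m → V1 m n, (∃ a, v a = y) → covector (c, P) v = 0) : y = 0 := by
  have hy1 : y.1 = 0 := by
    ext i
    -- Here `m ≥ 2` provides a second slot for the vertical vector, leaving slot `i` to `y`; `n ≥ 1`
    -- provides the vertical vector.
    obtain ⟨b, hb⟩ : ∃ b : Fin m, b ≠ i := by
      have : Nontrivial (Fin m) := Fin.nontrivial_iff_two_le.2 hm
      exact exists_ne i
    obtain ⟨c, hc⟩ := h (Pi.single b (Pi.single ⟨0, hn⟩ 1), 0)
    have := hc (Function.update (Function.update (fun k => dX k) i y) b (dU ⟨0, hn⟩))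
      ⟨i, by simp [hb.symm]⟩
    rw [covector_update _ _ _ _ rfl] at this
    have hT : momMap (Pi.single b (Pi.single ⟨0, hn⟩ 1), 0) (dU ⟨0, hn⟩ : V1 m n) = e b := by
      ext j
      by_cases hj : j = b
      · subst hj; simp [momMap_apply, dU, e_apply]
      · simp [momMap_apply, dU, e_apply, hj]
    have hE : Function.update (Function.update (fun k : Fin m => (dX k : V1 m n).1) i y.1) b (e b) =
        Function.update (fun k => e k) i y.1 := by
      ext1 k
      by_cases hk : k = b
      · subst hk; simp [hb]
      · rw [Function.update_of_ne hk]; rfl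
    rw [hT, update_fst, hE, detX_update] at this
    simpa using this
  have hT : ∀ P i, momMap P y i = 0 := by
    intro P i
    obtain ⟨c, hc⟩ := h P
    have := hc (Function.update (fun k => dX k) i y) ⟨i, by simp⟩
    rw [covector_update _ _ _ _ hy1] at this
    rw [← this]
    exact (detX_update _ _).symm
  refine Prod.ext hy1 (Prod.ext ?_ ?_)
  · ext α
    by_cases hm0 : m = 0
    · omega
    · let i : Fin m := ⟨0, by omega⟩
      have := hT (Pi.single i (Pi.single α 1), 0) i
      simpa [momMap_apply, Pi.single_apply] using this
  · ext i α
    -- Diagonal multi-indices are enough: `1_i + 1_i` has `n(ii) = 1`, and no other pair in row `i`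
    -- produces it.
    have := hT (0, Pi.single (idx2 i i) (Pi.single α 1)) i
    rw [momMap_apply, Finset.sum_eq_single i] at this
    · simpa [nij, Pi.single_apply] using this
    · intro k _ hk
      have : idx2 k i ≠ idx2 i i := by
        rw [Ne, idx2_eq_iff]; simp [hk]
      simp [this]
    · simp

/-- The pullback of the tautological form by `z ↦ p(z) d^mx + …`. -/
def cartanForm (p : VDDag m n → ℝ) (z : VDDag m n) : VDDag m n [⋀^Fin m]→L[ℝ] ℝ :=
  (covector (p z, z.2)).compContinuousLinearMap (ContinuousLinearMap.fst ℝ _ _)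

theorem contDiffAt_cartanForm {p : VDDag m n → ℝ} {z : VDDag m n} (hp : ContDiffAt ℝ ∞ p z) :
    ContDiffAt ℝ ∞ (cartanForm p) z := by
  have : cartanForm p = (ContinuousAlternatingMap.compContinuousLinearMapCLM
      (ContinuousLinearMap.fst ℝ (V1 m n) ((Fin m → Fin n → ℝ) × (Sym (Fin m) 2 → Fin n → ℝ))) ∘L
      (SymMom m n).subtypeL ∘L covectorCLM m n) ∘ fun z => (p z, z.2) := rfl
  rw [this]
  exact (ContinuousLinearMap.contDiff _).comp_contDiffAt _ (hp.prodMk contDiffAt_snd)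

/-- The form depends on the point only through `(p, P)`, and linearly. Its derivative along a vector
is therefore the covector with the differentiated coefficients, pulled back along the fixed
projection to first jets. -/
theorem extDeriv_cartanForm {p : VDDag m n → ℝ} {z : VDDag m n} (hp : ContDiffAt ℝ ∞ p z)
    (v : Fin (m + 1) → VDDag m n) :
    extDeriv (cartanForm p) z v = ∑ i, (-1) ^ i.val •
      covector (fderiv ℝ p z (v i), (v i).2) (fun k => (i.removeNth v k).1) := by
  rw [extDeriv_apply ((contDiffAt_cartanForm hp).differentiableAt (by simp))]
  refine Finset.sum_congr rfl fun i _ => ?_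
  congr 1
  have h1 : HasFDerivAt (fun z : VDDag m n => (p z, z.2)) ((fderiv ℝ p z).prod
      (ContinuousLinearMap.snd ℝ _ _)) z :=
    (hp.differentiableAt (by simp)).hasFDerivAt.prodMk hasFDerivAt_snd
  have h2 : (fun z' : VDDag m n => cartanForm p z' (i.removeNth v)) =
      (ContinuousAlternatingMap.apply ℝ (V1 m n) ℝ (fun k => (i.removeNth v k).1) ∘L
      (SymMom m n).subtypeL ∘L covectorCLM m n) ∘ fun z => (p z, z.2) := rfl
  rw [h2, ((ContinuousLinearMap.hasFDerivAt _).comp z h1).fderiv]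
  rfl

/-- Test first with one pure momentum vector `(0, P)` and lifts `(v, 0)`. Only the summand
differentiating along `(0, P)` survives, since elsewhere that vector projects to zero; this forces
`Y.1 = 0`. Then test with lifts only: every summand but the one differentiating along `Y` contains
`Y.1 = 0`. -/
theorem cartanForm_nondegenerate (hm : 2 ≤ m) (hn : 1 ≤ n) {p : VDDag m n → ℝ} {z : VDDag m n}
    (hp : ContDiffAt ℝ ∞ p z) {Y : VDDag m n}
    (h : ∀ v : Fin m → VDDag m n, extDeriv (cartanForm p) z (Fin.cons Y v) = 0) : Y = 0 := by
  simp only [extDeriv_cartanForm hp] at h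
  have hY : Y.1 = 0 := by
    refine eq_zero_of_covector_eq_zero hm hn fun P => ⟨fderiv ℝ p z (0, P), ?_⟩
    obtain ⟨k, rfl⟩ : ∃ k, m = k + 1 := ⟨m - 1, by omega⟩
    have key : ∀ v : Fin (k + 1) → V1 (k + 1) n, v 0 = Y.1 →
        covector (fderiv ℝ p z (0, P), P) v = 0 := by
      intro v hv
      have := h (Fin.cons (0, P) fun j => (v j.succ, 0))
      rw [Finset.sum_eq_single (Fin.succ 0)] at this
      · have h2 : (fun j => ((Fin.succ 0).removeNth (Fin.cons Y (Fin.cons (0, P)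
            fun j => (v j.succ, 0)) : Fin (k + 2) → VDDag (k + 1) n) j).1) = v := by
          ext1 j
          refine Fin.cases ?_ (fun j => ?_) j
          · simp [Fin.removeNth, hv]
          · simp only [Fin.removeNth, Fin.succ_succAbove_succ, Fin.cons_succ]
            simp
        rw [h2] at this
        simpa using this
      · intro i _ hi
        obtain ⟨j, hj⟩ := Fin.exists_succAbove_eq hi.symm
        rw [ContinuousAlternatingMap.map_coord_zero _ j, smul_zero]
        simp [Fin.removeNth, hj]
      · simp
    -- A transposition moves `Y.1` from slot `a` to slot `0`, at the cost of a sign.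
    rintro v ⟨a, ha⟩
    have := key (v ∘ Equiv.swap 0 a) (by simpa using ha)
    have h3 := (covector (fderiv ℝ p z (0, P), P)).toAlternatingMap.map_perm v (Equiv.swap 0 a)
    rw [ContinuousAlternatingMap.coe_toAlternatingMap, this] at h3
    exact (smul_eq_zero_iff_eq _).1 h3.symm
  have h0 : covector (fderiv ℝ p z Y, Y.2) = 0 := by
    ext v
    have := h fun k => (v k, 0)
    rw [Finset.sum_eq_single 0] at this
    · simpa [Fin.removeNth] using this
    · intro i _ hi
      obtain ⟨j, hj⟩ := Fin.exists_succAbove_eq hi.symm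
      rw [ContinuousAlternatingMap.map_coord_zero _ j, smul_zero]
      simp [Fin.removeNth, hj, hY]
    · simp
  refine Prod.ext hY ?_
  -- The map from coefficients to covectors has a left inverse, so a vanishing covector has
  -- vanishing momenta `Y.2`.
  have h1 := coeffs_covector (fderiv ℝ p z Y, Y.2)
  have h2 := coeffs_covector (m := m) (n := n) 0
  have h3 : covector (m := m) (n := n) 0 = 0 := by
    simpa using covector_smul (m := m) (n := n) 0 0
  rw [h0, ← h3, h2] at h1
  exact (congrArg Prod.snd h1).symm

end Nondegenerate

/-! ### Taylor coefficients of compositions -/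

section Taylor

variable {V W Z : Type*} [NormedAddCommGroup V] [NormedSpace ℝ V] [NormedAddCommGroup W]
  [NormedSpace ℝ W] [NormedAddCommGroup Z] [NormedSpace ℝ Z]

theorem eq_of_iteratedFDeriv_zero_eq {f f' : V → W} {x : V}
    (h : iteratedFDeriv ℝ 0 f x = iteratedFDeriv ℝ 0 f' x) : f x = f' x := by
  have := congrArg (fun A => A ![]) h
  simpa using this

/-- By the Faà di Bruno formula, the `r`-th derivative of a composite involves only derivatives of
order at most `r` of the two factors. -/
theorem iteratedFDeriv_comp_congr {f f' : V → W} {g g' : W → Z} {x : V} {k : ℕ}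
    (hf : ContDiffAt ℝ k f x) (hf' : ContDiffAt ℝ k f' x) (hg : ContDiffAt ℝ k g (f x))
    (hg' : ContDiffAt ℝ k g' (f x))
    (h : ∀ r ≤ k, iteratedFDeriv ℝ r f x = iteratedFDeriv ℝ r f' x)
    (h' : ∀ r ≤ k, iteratedFDeriv ℝ r g (f x) = iteratedFDeriv ℝ r g' (f x)) :
    ∀ r ≤ k, iteratedFDeriv ℝ r (g ∘ f) x = iteratedFDeriv ℝ r (g' ∘ f') x := by
  intro r hr
  have h0 : f x = f' x := eq_of_iteratedFDeriv_zero_eq (h 0 (Nat.zero_le _))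
  rw [iteratedFDeriv_comp hg hf (by exact_mod_cast hr),
    iteratedFDeriv_comp (h0 ▸ hg') hf' (by exact_mod_cast hr), ← h0]
  simp only [FormalMultilinearSeries.taylorComp]
  refine Finset.sum_congr rfl fun c _ => ?_
  have e1 : ftaylorSeries ℝ g (f x) c.length = ftaylorSeries ℝ g' (f x) c.length :=
    h' _ (c.length_le.trans hr)
  have e2 : (fun i => ftaylorSeries ℝ f x (c.partSize i)) =
      fun i => ftaylorSeries ℝ f' x (c.partSize i) :=
    funext fun i => h _ ((c.partSize_le i).trans hr)
  simp only [FormalMultilinearSeries.compAlongOrderedFinpartition, e1, e2]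

end Taylor

/-! ### Jets of maps and their coordinates -/

section Jets

variable {m n : ℕ}

theorem clm_ext_e {W : Type*} [NormedAddCommGroup W] [NormedSpace ℝ W] {k : ℕ}
    {f g : EuclideanSpace ℝ (Fin k) →L[ℝ] W} (h : ∀ i, f (e i) = g (e i)) : f = g := by
  ext x
  rw [← sum_smul_e x, map_sum, map_sum]
  simp only [map_smul, h]

theorem fderiv_eq_of_iteratedFDeriv_one_eq {f g : X m → U n} {x : X m}
    (h : iteratedFDeriv ℝ 1 f x = iteratedFDeriv ℝ 1 g x) : fderiv ℝ f x = fderiv ℝ g x := by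
  ext1 v
  have := congrArg (fun A => A ![v]) h
  simpa [iteratedFDeriv_one_apply] using this

theorem prolong1_congr {f g : X m → U n} {x : X m}
    (h : ∀ r ≤ 1, iteratedFDeriv ℝ r f x = iteratedFDeriv ℝ r g x) :
    prolong1 f x = prolong1 g x := by
  simp only [prolong1, eq_of_iteratedFDeriv_zero_eq (h 0 (by norm_num)),
    fderiv_eq_of_iteratedFDeriv_one_eq (h 1 le_rfl)]

theorem prolong2_congr {f g : X m → U n} {x : X m}
    (h : ∀ r ≤ 2, iteratedFDeriv ℝ r f x = iteratedFDeriv ℝ r g x) :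
    prolong2 f x = prolong2 g x := by
  simp only [prolong2, prolong1_congr fun r hr => h r (hr.trans (by norm_num)), pderiv,
    h 2 le_rfl]

theorem prolong3_congr {f g : X m → U n} {x : X m}
    (h : ∀ r ≤ 3, iteratedFDeriv ℝ r f x = iteratedFDeriv ℝ r g x) :
    prolong3 f x = prolong3 g x := by
  simp only [prolong3, prolong2_congr fun r hr => h r (hr.trans (by norm_num)), pderiv,
    h 3 le_rfl]

theorem iteratedFDeriv_eq_of_prolong1_eq {f g : X m → U n} {x : X m}
    (h : prolong1 f x = prolong1 g x) :
    ∀ r ≤ 1, iteratedFDeriv ℝ r f x = iteratedFDeriv ℝ r g x := by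
  simp only [prolong1, Prod.mk.injEq, true_and] at h
  intro r hr
  interval_cases r
  · ext v; simp [h.1]
  · ext1 v
    rw [iteratedFDeriv_one_apply, iteratedFDeriv_one_apply, clm_ext_e fun i => congrFun h.2 i]

/-- The list underlying the multi-index may come in either order; symmetry of the second derivative
makes the two cases agree. -/
theorem pderiv_idx2 {f : X m → U n} {x : X m} (hf : ContDiffAt ℝ 2 f x) (i j : Fin m) :
    pderiv (idx2 i j) f x = fderiv ℝ (fderiv ℝ f) x (e i) (e j) := by
  have hsymm : IsSymmSndFDerivAt ℝ f x := hf.isSymmSndFDerivAt (by simp)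
  rw [pderiv, iteratedFDeriv_two_apply]
  have hl : ∀ (a b : Fin m) (I : Sym (Fin m) 2) (l : List (Fin m))
      (hI : (I : Multiset (Fin m)).toList = l) (hl : l = [a, b]),
      (∀ h0 : 0 < (I : Multiset (Fin m)).toList.length,
        (I : Multiset (Fin m)).toList.get ⟨0, h0⟩ = a) ∧
      (∀ h1 : 1 < (I : Multiset (Fin m)).toList.length,
        (I : Multiset (Fin m)).toList.get ⟨1, h1⟩ = b) := by
    rintro a b I l hI rfl
    simp [hI]
  have hcoe : (((idx2 i j : Sym (Fin m) 2) : Multiset (Fin m)).toList : Multiset (Fin m)) =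
      ([i, j] : List (Fin m)) := by
    rw [Multiset.coe_toList]; rfl
  have hperm : ((idx2 i j : Sym (Fin m) 2) : Multiset (Fin m)).toList = [i, j] ∨
      ((idx2 i j : Sym (Fin m) 2) : Multiset (Fin m)).toList = [j, i] := by
    have := (Multiset.coe_eq_coe.1 hcoe)
    exact List.perm_pair.1 this
  rcases hperm with h | h
  · obtain ⟨h0, h1⟩ := hl i j _ _ h rfl
    exact congrArg₂ (fun a b => fderiv ℝ (fderiv ℝ f) x (e a) (e b)) (h0 _) (h1 _)
  · obtain ⟨h0, h1⟩ := hl j i _ _ h rfl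
    rw [hsymm (e i) (e j)]
    exact congrArg₂ (fun a b => fderiv ℝ (fderiv ℝ f) x (e a) (e b)) (h0 _) (h1 _)

/-- The entries indexed by unordered pairs fill the whole Hessian because it is symmetric. This
yields injectivity of the coordinates on second jets. -/
theorem iteratedFDeriv_eq_of_prolong2_eq {f g : X m → U n} {x : X m} (hf : ContDiffAt ℝ 2 f x)
    (hg : ContDiffAt ℝ 2 g x) (h : prolong2 f x = prolong2 g x) :
    ∀ r ≤ 2, iteratedFDeriv ℝ r f x = iteratedFDeriv ℝ r g x := by
  intro r hr
  have h1 := iteratedFDeriv_eq_of_prolong1_eq (congrArg Prod.fst h)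
  rcases hr.lt_or_eq with hr | rfl
  · exact h1 r (by omega)
  · have h2 : fderiv ℝ (fderiv ℝ f) x = fderiv ℝ (fderiv ℝ g) x := by
      refine clm_ext_e fun i => clm_ext_e fun j => ?_
      rw [← pderiv_idx2 hf, ← pderiv_idx2 hg]
      exact congrFun (congrArg Prod.snd h) (idx2 i j)
    ext1 v
    rw [iteratedFDeriv_two_apply, iteratedFDeriv_two_apply, h2]

end Jets

theorem localExpr_apply {N V Y : Type*} [Zero Y] {dom : Set N} {coord : N → V} (F : N → Y)
    (h : Set.InjOn coord dom) {p : N} (hp : p ∈ dom) : localExpr dom coord F (coord p) = F p :=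
  (Function.Injective.extend_apply (f := fun p : dom => coord p)
    (fun a b hab => Subtype.ext (h a.2 b.2 hab)) _ _ ⟨p, hp⟩)

/-! ### Sections and jets in adapted charts -/

section Charts

variable {m n : ℕ} {M E : Type*}
  [TopologicalSpace M] [ChartedSpace (X m) M]
  [TopologicalSpace E] [ChartedSpace (X m × U n) E]
  {π : E → M}

namespace LocalSection

variable (s : LocalSection m n π)

theorem proj_pt : π (s.toFun s.pt) = s.pt := s.isSection.self_of_nhds

/-- The same section, considered around a nearby point. -/
def shift (x : M) (h : ∀ᶠ x' in 𝓝 x, ContMDiffAt (𝓡 m) 𝓘(ℝ, X m × U n) ∞ s.toFun x')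
    (h' : ∀ᶠ x' in 𝓝 x, π (s.toFun x') = x') : LocalSection m n π := ⟨x, s.toFun, h, h'⟩

end LocalSection

namespace AdaptedChart

variable (c c' : AdaptedChart m n π)

theorem base_mem_source {φ : M → E} {x : M} (hx : φ x ∈ c.total.source) (h : π (φ x) = x) :
    x ∈ c.base.source := h ▸ c.mapsTo _ hx

theorem total_apply {φ : M → E} {x : M} (hx : φ x ∈ c.total.source) (h : π (φ x) = x) :
    c.total (φ x) = (c.base x, c.localRep φ (c.base x)) := by
  have hb := c.base_mem_source hx h
  refine Prod.ext ?_ ?_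
  · rw [c.adapted _ hx, h]
  · simp only [localRep, c.base.left_inv hb]

theorem proj_symm {z : X m × U n} (hz : z ∈ c.total.target) :
    π (c.total.symm z) = c.base.symm z.1 ∧ z.1 ∈ c.base.target := by
  have h1 := c.total.map_target hz
  have h2 := c.adapted _ h1
  rw [c.total.right_inv hz] at h2
  have h3 := c.mapsTo _ h1
  rw [h2]
  exact ⟨(c.base.left_inv h3).symm, c.base.map_source h3⟩

theorem pt_mem {s : LocalSection m n π} (hs : s.toFun s.pt ∈ c.total.source) :
    s.pt ∈ c.base.source := c.base_mem_source hs s.proj_pt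

theorem eventually_mem {s : LocalSection m n π} (hs : s.toFun s.pt ∈ c.total.source) :
    ∀ᶠ x in 𝓝 s.pt, s.toFun x ∈ c.total.source :=
  s.smooth.self_of_nhds.continuousAt.eventually_mem (c.total.open_source.mem_nhds hs)

theorem contDiffAt_localRep {φ : M → E} {x : M} (hx : φ x ∈ c.total.source) (h : π (φ x) = x)
    (hφ : ContMDiffAt (𝓡 m) 𝓘(ℝ, X m × U n) ∞ φ x) :
    ContDiffAt ℝ ∞ (c.localRep φ) (c.base x) := by
  have hb := c.base_mem_source hx h
  rw [← contMDiffAt_iff_contDiffAt]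
  have h1 : ContMDiffAt (𝓡 m) (𝓡 m) ∞ c.base.symm (c.base x) :=
    contMDiffAt_symm_of_mem_maximalAtlas c.base_mem (c.base.map_source hb)
  have h2 : ContMDiffAt 𝓘(ℝ, X m × U n) 𝓘(ℝ, X m × U n) ∞ c.total (φ x) :=
    contMDiffAt_of_mem_maximalAtlas c.total_mem hx
  have h3 : ContMDiffAt 𝓘(ℝ, X m × U n) 𝓘(ℝ, U n) ∞ (Prod.snd : X m × U n → U n)
      (c.total (φ x)) := contDiffAt_snd.contMDiffAt
  have h4 : ContMDiffAt (𝓡 m) 𝓘(ℝ, X m × U n) ∞ (φ ∘ c.base.symm) (c.base x) :=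
    ContMDiffAt.comp (c.base x) (by rwa [c.base.left_inv hb]) h1
  have h5 : ContMDiffAt (𝓡 m) 𝓘(ℝ, X m × U n) ∞ (c.total ∘ φ ∘ c.base.symm) (c.base x) :=
    ContMDiffAt.comp (c.base x) (by simpa [c.base.left_inv hb] using h2) h4
  exact ContMDiffAt.comp (c.base x) (by simpa [c.base.left_inv hb] using h3) h5

theorem contDiffAt_localRep_pt {s : LocalSection m n π} (hs : s.toFun s.pt ∈ c.total.source) :
    ContDiffAt ℝ ∞ (c.localRep s.toFun) (c.base s.pt) :=
  c.contDiffAt_localRep hs s.proj_pt s.smooth.self_of_nhds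

/-- The change of base coordinates. -/
def changeBase : X m → X m := c'.base ∘ c.base.symm

/-- The change of coordinates of the total space. -/
def changeTotal : X m × U n → X m × U n := c'.total ∘ c.total.symm

variable {c c'}

theorem changeBase_apply {x : M} (hx : x ∈ c.base.source) :
    c.changeBase c' (c.base x) = c'.base x := by
  simp [changeBase, c.base.left_inv hx]

theorem contDiffAt_changeBase {x : M} (hx : x ∈ c.base.source) (hx' : x ∈ c'.base.source) :
    ContDiffAt ℝ ∞ (c.changeBase c') (c.base x) := by
  rw [← contMDiffAt_iff_contDiffAt]
  have h1 : ContMDiffAt (𝓡 m) (𝓡 m) ∞ c.base.symm (c.base x) :=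
    contMDiffAt_symm_of_mem_maximalAtlas c.base_mem (c.base.map_source hx)
  have h2 : ContMDiffAt (𝓡 m) (𝓡 m) ∞ c'.base (c.base.symm (c.base x)) := by
    rw [c.base.left_inv hx]
    exact contMDiffAt_of_mem_maximalAtlas c'.base_mem hx'
  exact h2.comp _ h1

theorem contDiffAt_changeTotal {y : E} (hy : y ∈ c.total.source) (hy' : y ∈ c'.total.source) :
    ContDiffAt ℝ ∞ (c.changeTotal c') (c.total y) := by
  rw [← contMDiffAt_iff_contDiffAt]
  have h1 : ContMDiffAt 𝓘(ℝ, X m × U n) 𝓘(ℝ, X m × U n) ∞ c.total.symm (c.total y) :=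
    contMDiffAt_symm_of_mem_maximalAtlas c.total_mem (c.total.map_source hy)
  have h2 : ContMDiffAt 𝓘(ℝ, X m × U n) 𝓘(ℝ, X m × U n) ∞ c'.total
      (c.total.symm (c.total y)) := by
    rw [c.total.left_inv hy]
    exact contMDiffAt_of_mem_maximalAtlas c'.total_mem hy'
  exact h2.comp _ h1

theorem localRep_change {φ : M → E} {x : M} (hx : φ x ∈ c.total.source)
    (hx' : φ x ∈ c'.total.source) (h : π (φ x) = x) :
    c'.localRep φ (c'.base x) = (c.changeTotal c' (c.base x, c.localRep φ (c.base x))).2 := by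
  rw [← c.total_apply hx h, changeTotal, Function.comp_apply, c.total.left_inv hx,
    c'.total_apply hx' h]

/-- The graph of the section is moved by the change of total coordinates and then reparametrised by
the inverse change of base coordinates. Chart independence of jets and the first-jet transition
formula both come from this rule. -/
theorem eventually_localRep_change {s : LocalSection m n π} (hs : s.toFun s.pt ∈ c.total.source)
    (hs' : s.toFun s.pt ∈ c'.total.source) :
    c'.localRep s.toFun =ᶠ[𝓝 (c'.base s.pt)] ((Prod.snd ∘ c.changeTotal c') ∘
      fun y => (y, c.localRep s.toFun y)) ∘ c'.changeBase c := by
  have hb := c'.pt_mem hs'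
  have h1 : ∀ᶠ x in 𝓝 s.pt, s.toFun x ∈ c.total.source ∧ s.toFun x ∈ c'.total.source ∧
      π (s.toFun x) = x :=
    (c.eventually_mem hs).and ((c'.eventually_mem hs').and s.isSection)
  have h2 : Filter.Tendsto c'.base.symm (𝓝 (c'.base s.pt)) (𝓝 s.pt) := by
    have := (c'.base.continuousAt_symm (c'.base.map_source hb))
    rwa [ContinuousAt, c'.base.left_inv hb] at this
  filter_upwards [h2.eventually h1, c'.base.open_target.mem_nhds (c'.base.map_source hb)]
    with y ⟨hy1, hy2, hy3⟩ hy4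
  have := localRep_change hy1 hy2 hy3
  rw [c'.base.right_inv hy4] at this
  simpa [changeBase] using this

/-- Equality of the derivatives up to order `k` does not depend on the adapted chart. -/
theorem iteratedFDeriv_localRep_congr {s t : LocalSection m n π} (hpt : t.pt = s.pt)
    (hval : t.toFun t.pt = s.toFun s.pt) (hs : s.toFun s.pt ∈ c.total.source)
    (hs' : s.toFun s.pt ∈ c'.total.source) {k : ℕ}
    (h : ∀ r ≤ k, iteratedFDeriv ℝ r (c.localRep s.toFun) (c.base s.pt) =
      iteratedFDeriv ℝ r (c.localRep t.toFun) (c.base s.pt)) :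
    ∀ r ≤ k, iteratedFDeriv ℝ r (c'.localRep s.toFun) (c'.base s.pt) =
      iteratedFDeriv ℝ r (c'.localRep t.toFun) (c'.base s.pt) := by
  have ht : t.toFun t.pt ∈ c.total.source := hval ▸ hs
  have ht' : t.toFun t.pt ∈ c'.total.source := hval ▸ hs'
  have hk : (k : ℕ∞ω) ≤ ∞ := by exact_mod_cast le_top
  have es := eventually_localRep_change hs hs'
  have et := eventually_localRep_change ht ht'
  have hb := c'.pt_mem hs'
  have hχ := (contDiffAt_changeBase hb (c.pt_mem hs)).of_le hk
  have hχb := changeBase_apply (c := c') (c' := c) hb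
  have cs := (c.contDiffAt_localRep_pt hs).of_le hk
  have ct := (c.contDiffAt_localRep_pt ht).of_le hk
  have hψ := (contDiffAt_changeTotal hs hs').of_le hk
  rw [c.total_apply hs s.proj_pt] at hψ
  rw [hpt] at et ct
  have hψ2 : ContDiffAt ℝ k (Prod.snd ∘ c.changeTotal c') (c.base s.pt,
      c.localRep s.toFun (c.base s.pt)) := contDiffAt_snd.comp _ hψ
  have h0 : c.localRep s.toFun (c.base s.pt) = c.localRep t.toFun (c.base s.pt) :=
    eq_of_iteratedFDeriv_zero_eq (h 0 (Nat.zero_le _))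
  intro r hr
  rw [(es.iteratedFDeriv ℝ r).self_of_nhds, (et.iteratedFDeriv ℝ r).self_of_nhds]
  have ids : ContDiffAt ℝ k (fun y => (y, c.localRep s.toFun y)) (c.base s.pt) :=
    contDiffAt_id.prodMk cs
  have idt : ContDiffAt ℝ k (fun y => (y, c.localRep t.toFun y)) (c.base s.pt) :=
    contDiffAt_id.prodMk ct
  -- The composition lemma is applied twice, once for the base reparametrisation and once for the
  -- graph map; only the graph depends on the section.
  refine iteratedFDeriv_comp_congr hχ hχ ?_ ?_ (fun _ _ => rfl) ?_ r hr
  · rw [hχb]; exact ContDiffAt.comp _ hψ2 ids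
  · rw [hχb]; exact ContDiffAt.comp _ (by rw [← h0]; exact hψ2) idt
  · rw [hχb]
    refine iteratedFDeriv_comp_congr ids idt hψ2 hψ2 (fun r hr => ?_) fun _ _ => rfl
    have hrk : (r : ℕ∞ω) ≤ k := by exact_mod_cast hr
    rw [iteratedFDeriv_prodMk contDiffAt_fun_id cs hrk, iteratedFDeriv_prodMk contDiffAt_fun_id ct hrk, h r hr]

/-- Jet equality quantifies over all adapted charts, but the chain rule reduces it to a single one.
-/
theorem jet_eq_of_iteratedFDeriv_eq {s t : LocalSection m n π}
    (hs : s.toFun s.pt ∈ c.total.source) (ht : t.toFun t.pt ∈ c.total.source) {k : ℕ}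
    (hb : c.base s.pt = c.base t.pt)
    (h : ∀ r ≤ k, iteratedFDeriv ℝ r (c.localRep s.toFun) (c.base s.pt) =
      iteratedFDeriv ℝ r (c.localRep t.toFun) (c.base s.pt)) :
    (Quotient.mk (jetSetoid m n π k) s : Jet m n π k) = Quotient.mk (jetSetoid m n π k) t := by
  have hpt : t.pt = s.pt := (c.base.injOn (c.pt_mem hs) (c.pt_mem ht) hb).symm
  have hval : t.toFun t.pt = s.toFun s.pt := by
    refine c.total.injOn ht hs ?_
    rw [c.total_apply ht t.proj_pt, c.total_apply hs s.proj_pt, ← hb,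
      eq_of_iteratedFDeriv_zero_eq (h 0 (Nat.zero_le _))]
  refine Quotient.sound ⟨hpt.symm, hval.symm, fun c' hc' r hr => ?_⟩
  rw [hpt]
  exact iteratedFDeriv_localRep_congr hpt hval hs hc' h r hr

/-- Jet coordinates are defined through a chosen representative; this allows it to be replaced by
any section with the same jet. -/
theorem iteratedFDeriv_rep (c : AdaptedChart m n π) {k : ℕ} {s : LocalSection m n π}
    (hs : s.toFun s.pt ∈ c.total.source) :
    (Jet.rep (Quotient.mk (jetSetoid m n π k) s)).pt = s.pt ∧
    ∀ r ≤ k, iteratedFDeriv ℝ r (c.localRep (Jet.rep (Quotient.mk (jetSetoid m n π k) s)).toFun)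
      (c.base s.pt) = iteratedFDeriv ℝ r (c.localRep s.toFun) (c.base s.pt) := by
  obtain ⟨h1, h2, h3⟩ := Quotient.mk_out (s := jetSetoid m n π k) s
  refine ⟨h1, fun r hr => ?_⟩
  have := h3 c (by rw [h2]; exact hs) r hr
  rw [h1] at this
  exact this

theorem coord1_mk (c : AdaptedChart m n π) {s : LocalSection m n π} (hs : s.toFun s.pt ∈ c.total.source) :
    c.coord1 (Quotient.mk (jetSetoid m n π 1) s) = prolong1 (c.localRep s.toFun) (c.base s.pt) := by
  obtain ⟨h1, h2⟩ := iteratedFDeriv_rep (k := 1) c hs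
  change prolong1 (c.localRep (Jet.rep _).toFun) (c.base (Jet.rep _).pt) = _
  rw [h1]
  exact prolong1_congr h2

theorem coord2_mk (c : AdaptedChart m n π) {s : LocalSection m n π} (hs : s.toFun s.pt ∈ c.total.source) :
    c.coord2 (Quotient.mk (jetSetoid m n π 2) s) = prolong2 (c.localRep s.toFun) (c.base s.pt) := by
  obtain ⟨h1, h2⟩ := iteratedFDeriv_rep (k := 2) c hs
  change prolong2 (c.localRep (Jet.rep _).toFun) (c.base (Jet.rep _).pt) = _
  rw [h1]
  exact prolong2_congr h2

theorem coord3_mk (c : AdaptedChart m n π) {s : LocalSection m n π} (hs : s.toFun s.pt ∈ c.total.source) :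
    c.coord3 (Quotient.mk (jetSetoid m n π 3) s) = prolong3 (c.localRep s.toFun) (c.base s.pt) := by
  obtain ⟨h1, h2⟩ := iteratedFDeriv_rep (k := 3) c hs
  change prolong3 (c.localRep (Jet.rep _).toFun) (c.base (Jet.rep _).pt) = _
  rw [h1]
  exact prolong3_congr h2

theorem coord1_injOn (c : AdaptedChart m n π) : Set.InjOn c.coord1 (c.jetDom 1) := by
  intro j hj j' hj' h
  induction j using Quotient.inductionOn with | _ s => ?_
  induction j' using Quotient.inductionOn with | _ t => ?_
  have hs : s.toFun s.pt ∈ c.total.source := hj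
  have ht : t.toFun t.pt ∈ c.total.source := hj'
  rw [c.coord1_mk hs, c.coord1_mk ht] at h
  have hb : c.base s.pt = c.base t.pt := congrArg Prod.fst h
  rw [← hb] at h
  exact jet_eq_of_iteratedFDeriv_eq hs ht hb (iteratedFDeriv_eq_of_prolong1_eq h)

theorem coord2_injOn (c : AdaptedChart m n π) : Set.InjOn c.coord2 (c.jetDom 2) := by
  intro j hj j' hj' h
  induction j using Quotient.inductionOn with | _ s => ?_
  induction j' using Quotient.inductionOn with | _ t => ?_
  have hs : s.toFun s.pt ∈ c.total.source := hj
  have ht : t.toFun t.pt ∈ c.total.source := hj'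
  rw [c.coord2_mk hs, c.coord2_mk ht] at h
  have hb : c.base s.pt = c.base t.pt := congrArg (fun v => v.1.1) h
  rw [← hb] at h
  have hk : (2 : ℕ∞ω) ≤ ∞ := WithTop.coe_le_coe.2 (le_top : (2 : ℕ∞) ≤ ⊤)
  exact jet_eq_of_iteratedFDeriv_eq hs ht hb (iteratedFDeriv_eq_of_prolong2_eq
    ((c.contDiffAt_localRep_pt hs).of_le hk)
    (by rw [hb]; exact (c.contDiffAt_localRep_pt ht).of_le hk) h)

/-- Every value of the coordinates over the domain of `c` is attained at some first jet. -/
theorem exists_coord1_eq (c : AdaptedChart m n π) {v : V1 m n}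
    (hv : (v.1, v.2.1) ∈ c.total.target) : ∃ j ∈ c.jetDom 1, c.coord1 j = v := by
  obtain ⟨x, u, u1⟩ := v
  -- The jet is realised by the affine section `y ↦ u + D (y - x)`, where `D` has the prescribed
  -- first derivatives `u1`.
  let D : X m →L[ℝ] U n := LinearMap.toContinuousLinearMap
    (∑ i, LinearMap.smulRight (EuclideanSpace.proj i : X m →L[ℝ] ℝ).toLinearMap (u1 i))
  have hD : ∀ i, D (e i) = u1 i := by
    intro i
    simp [D, e_apply]
  let f : X m → U n := fun y => u + D (y - x)
  have hf : ContDiff ℝ ∞ f := contDiff_const.add (D.contDiff.comp (contDiff_id.sub contDiff_const))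
  let φ : M → E := fun p => c.total.symm (c.base p, f (c.base p))
  have hx : x ∈ c.base.target := (c.proj_symm hv).2
  have hxs : c.base.symm x ∈ c.base.source := c.base.map_target hx
  have hfx : f x = u := by simp [f]
  have hcont : ContinuousAt (fun p => (c.base p, f (c.base p))) (c.base.symm x) := by
    have := c.base.continuousAt hxs
    exact this.prodMk (hf.continuous.continuousAt.comp this)
  have hev : ∀ᶠ p in 𝓝 (c.base.symm x), p ∈ c.base.source ∧
      (c.base p, f (c.base p)) ∈ c.total.target := by
    refine (c.base.open_source.eventually_mem hxs).and (hcont.eventually_mem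
      (c.total.open_target.mem_nhds ?_))
    rw [c.base.right_inv hx, hfx]; exact hv
  let s : LocalSection m n π :=
    { pt := c.base.symm x
      toFun := φ
      smooth := by
        filter_upwards [hev] with p ⟨hp1, hp2⟩
        have h1 : ContMDiffAt (𝓡 m) (𝓡 m) ∞ c.base p :=
          contMDiffAt_of_mem_maximalAtlas c.base_mem hp1
        have h2 : ContMDiffAt 𝓘(ℝ, X m × U n) 𝓘(ℝ, X m × U n) ∞ c.total.symm
            (c.base p, f (c.base p)) := contMDiffAt_symm_of_mem_maximalAtlas c.total_mem hp2
        have h3 : ContMDiffAt (𝓡 m) 𝓘(ℝ, X m × U n) ∞ (fun y : X m => (y, f y)) (c.base p) :=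
          (contDiff_id.prodMk hf).contDiffAt.contMDiffAt
        exact ContMDiffAt.comp p h2 (ContMDiffAt.comp p h3 h1)
      isSection := by
        filter_upwards [hev] with p ⟨hp1, hp2⟩
        rw [(c.proj_symm hp2).1, c.base.left_inv hp1] }
  have hs : s.toFun s.pt ∈ c.total.source := by
    refine c.total.map_target ?_
    have := hev.self_of_nhds.2
    exact this
  refine ⟨Quotient.mk _ s, hs, ?_⟩
  rw [c.coord1_mk hs]
  have hloc : c.localRep s.toFun =ᶠ[𝓝 x] f := by
    have h2 := c.base.continuousAt_symm hx
    filter_upwards [h2.eventually hev, c.base.open_target.mem_nhds hx] with y ⟨hy1, hy2⟩ hy3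
    rw [c.base.right_inv hy3] at hy2
    simp only [localRep, s, φ, c.base.right_inv hy3, c.total.right_inv hy2]
  have hpt : c.base s.pt = x := c.base.right_inv hx
  rw [hpt, prolong1, hloc.fderiv_eq, hloc.self_of_nhds, hfx]
  have hfd : fderiv ℝ f x = D := by
    have h1 : HasFDerivAt (fun y => y - x) (ContinuousLinearMap.id ℝ (X m)) x :=
      (hasFDerivAt_id x).sub_const x
    have h2 : HasFDerivAt (fun y => D (y - x)) D x := D.hasFDerivAt.comp x h1
    have : HasFDerivAt f D x := h2.const_add u
    exact this.fderiv
  simp only [hfd, hD]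

end AdaptedChart

end Charts

/-! ### Transition maps on first jets -/

section ChangeOfCoordinates

variable {m n : ℕ} {M E : Type*}
  [TopologicalSpace M] [ChartedSpace (X m) M]
  [TopologicalSpace E] [ChartedSpace (X m × U n) E]
  {π : E → M}

namespace AdaptedChart

variable {c c' c'' : AdaptedChart m n π}

theorem coord1_total (c : AdaptedChart m n π) {j : Jet m n π 1} (hj : j ∈ c.jetDom 1) :
    ((c.coord1 j).1, (c.coord1 j).2.1) = c.total j.point := by
  induction j using Quotient.inductionOn with | _ s => ?_
  have hs : s.toFun s.pt ∈ c.total.source := hj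
  rw [c.coord1_mk hs]
  exact (c.total_apply hs s.proj_pt).symm

theorem jet_base_eq (j : Jet m n π 1) : π j.point = j.base := by
  induction j using Quotient.inductionOn with | _ s => ?_
  exact s.proj_pt

theorem coord1_base (c : AdaptedChart m n π) {j : Jet m n π 1} (hj : j ∈ c.jetDom 1) :
    (c.coord1 j).1 = c.base j.base := by
  have := congrArg Prod.fst (c.coord1_total hj)
  rw [c.adapted _ hj, jet_base_eq j] at this
  exact this

theorem jet_base_mem {j : Jet m n π 1} (hj : j ∈ c.jetDom 1) : j.base ∈ c.base.source := by
  rw [← jet_base_eq j]; exact c.mapsTo _ hj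

/-- The formula for the prolongation of a change of adapted coordinates to first jets. -/
def changeFormula (c c' : AdaptedChart m n π) (v : V1 m n) : V1 m n :=
  (c.changeBase c' v.1, (c.changeTotal c' (v.1, v.2.1)).2, fun i =>
    (fderiv ℝ (c.changeTotal c') (v.1, v.2.1)
      (fderiv ℝ (c'.changeBase c) (c.changeBase c' v.1) (e i),
        ∑ k, (fderiv ℝ (c'.changeBase c) (c.changeBase c' v.1) (e i)) k • v.2.2 k)).2)

theorem coord1_eq_changeFormula {j : Jet m n π 1} (hj : j ∈ c.jetDom 1) (hj' : j ∈ c'.jetDom 1) :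
    c'.coord1 j = c.changeFormula c' (c.coord1 j) := by
  induction j using Quotient.inductionOn with | _ s => ?_
  have hs : s.toFun s.pt ∈ c.total.source := hj
  have hs' : s.toFun s.pt ∈ c'.total.source := hj'
  have hb := c.pt_mem hs
  have hb' := c'.pt_mem hs'
  rw [c.coord1_mk hs, c'.coord1_mk hs']
  have hχ : HasFDerivAt (c'.changeBase c) _ (c'.base s.pt) :=
    ((contDiffAt_changeBase hb' hb).differentiableAt (by simp)).hasFDerivAt
  have hχb := changeBase_apply (c := c') (c' := c) hb'
  have hf : HasFDerivAt (c.localRep s.toFun) _ (c.base s.pt) :=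
    ((c.contDiffAt_localRep_pt hs).differentiableAt (by simp)).hasFDerivAt
  have hψ := contDiffAt_changeTotal hs hs'
  rw [c.total_apply hs s.proj_pt] at hψ
  have hψ' : HasFDerivAt (c.changeTotal c') _ (c.base s.pt, c.localRep s.toFun (c.base s.pt)) :=
    (hψ.differentiableAt (by simp)).hasFDerivAt
  have hψ2 := (hasFDerivAt_snd (𝕜 := ℝ)).comp _ hψ'
  have h1 := (hasFDerivAt_id (𝕜 := ℝ) (c.base s.pt)).prodMk hf
  have h2 := HasFDerivAt.comp (c.base s.pt) (g := Prod.snd ∘ c.changeTotal c') hψ2 h1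
  rw [← hχb] at h2
  have h3 := h2.comp (c'.base s.pt) hχ
  have h4 := h3.congr_of_eventuallyEq (eventually_localRep_change hs hs')
  rw [hχb] at h4
  simp only [changeFormula, prolong1, changeBase_apply hb, h4.fderiv]
  refine Prod.ext rfl (Prod.ext ?_ ?_)
  · exact localRep_change hs hs' s.proj_pt
  · ext1 i
    simp only [ContinuousLinearMap.comp_apply, ContinuousLinearMap.prod_apply,
      ContinuousLinearMap.coe_snd', ContinuousLinearMap.coe_id', id_eq]
    congr 3
    conv_lhs => rw [← sum_smul_e (fderiv ℝ (c'.changeBase c) (c'.base s.pt) (e i)), map_sum]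
    simp only [map_smul]

theorem change1_coord1 {j : Jet m n π 1} (hj : j ∈ c.jetDom 1) (hj' : j ∈ c'.jetDom 1) :
    c.change1 c' (c.coord1 j) = c'.coord1 j :=
  localExpr_apply _ (c.coord1_injOn.mono Set.inter_subset_left) ⟨hj, hj'⟩

/-- Near the coordinates of a jet, coordinates belong to jets with nearby values. -/
theorem eventually_exists_coord1 {j : Jet m n π 1} (hj : j ∈ c.jetDom 1) {s : Set E}
    (hs : IsOpen s) (hjs : j.point ∈ s) :
    ∀ᶠ v in 𝓝 (c.coord1 j), ∃ j' ∈ c.jetDom 1, j'.point ∈ s ∧ c.coord1 j' = v := by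
  have hcont : ContinuousAt (fun v : V1 m n => (v.1, v.2.1)) (c.coord1 j) := by fun_prop
  have hopen : IsOpen (c.total.symm.source ∩ c.total.symm ⁻¹' s) :=
    c.total.symm.isOpen_inter_preimage hs
  have hmem : ((c.coord1 j).1, (c.coord1 j).2.1) ∈ c.total.symm.source ∩ c.total.symm ⁻¹' s := by
    rw [c.coord1_total hj]
    exact ⟨c.total.map_source hj, by
      rw [Set.mem_preimage, c.total.left_inv hj]; exact hjs⟩
  filter_upwards [hcont.eventually_mem (hopen.mem_nhds hmem)] with v hv
  obtain ⟨j', hj', rfl⟩ := c.exists_coord1_eq hv.1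
  refine ⟨j', hj', ?_, rfl⟩
  have := hv.2
  rw [Set.mem_preimage, c.coord1_total hj', c.total.left_inv hj'] at this
  exact this

/-- `change1` is extended by zero off the range of the coordinates, so it can be differentiated only
because all nearby coordinates come from jets in both charts. -/
theorem change1_eventuallyEq {j : Jet m n π 1} (hj : j ∈ c.jetDom 1) (hj' : j ∈ c'.jetDom 1) :
    c.change1 c' =ᶠ[𝓝 (c.coord1 j)] c.changeFormula c' := by
  filter_upwards [eventually_exists_coord1 hj c'.total.open_source hj']
  rintro _ ⟨j', h1, h2, rfl⟩
  rw [change1_coord1 h1 h2, coord1_eq_changeFormula h1 h2]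

theorem contDiffAt_changeFormula {j : Jet m n π 1} (hj : j ∈ c.jetDom 1)
    (hj' : j ∈ c'.jetDom 1) : ContDiffAt ℝ ∞ (c.changeFormula c') (c.coord1 j) := by
  have hb := jet_base_mem hj
  have hb' := jet_base_mem hj'
  have h1 : ContDiffAt ℝ ∞ (c.changeBase c') (c.coord1 j).1 := by
    rw [c.coord1_base hj]; exact contDiffAt_changeBase hb hb'
  have h2 : ContDiffAt ℝ ∞ (c.changeTotal c') ((c.coord1 j).1, (c.coord1 j).2.1) := by
    rw [c.coord1_total hj]; exact contDiffAt_changeTotal hj hj'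
  have h3 : ContDiffAt ℝ ∞ (c'.changeBase c) (c.changeBase c' (c.coord1 j).1) := by
    rw [c.coord1_base hj, changeBase_apply hb]; exact contDiffAt_changeBase hb' hb
  have hp : ContDiffAt ℝ ∞ (fun v : V1 m n => (v.1, v.2.1)) (c.coord1 j) := by fun_prop
  have h1' : ContDiffAt ℝ ∞ (fun v : V1 m n => c.changeBase c' v.1) (c.coord1 j) :=
    ContDiffAt.comp (g := c.changeBase c') (c.coord1 j) h1 contDiffAt_fst
  have h2' : ContDiffAt ℝ ∞ (fun v : V1 m n => c.changeTotal c' (v.1, v.2.1)) (c.coord1 j) :=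
    ContDiffAt.comp (g := c.changeTotal c') (c.coord1 j) h2 hp
  have h4 : ContDiffAt ℝ ∞ (fun v : V1 m n => fderiv ℝ (c.changeTotal c') (v.1, v.2.1))
      (c.coord1 j) :=
    (h2.fderiv_right (m := ∞) (by simp)).comp (c.coord1 j) hp
  have h5 : ContDiffAt ℝ ∞ (fun v : V1 m n => fderiv ℝ (c'.changeBase c) (c.changeBase c' v.1))
      (c.coord1 j) :=
    (h3.fderiv_right (m := ∞) (by simp)).comp (c.coord1 j) h1'
  have h6 : ∀ i, ContDiffAt ℝ ∞ (fun v : V1 m n => fderiv ℝ (c'.changeBase c)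
      (c.changeBase c' v.1) (e i)) (c.coord1 j) := fun i => h5.clm_apply contDiffAt_const
  have h7 : ∀ i k, ContDiffAt ℝ ∞ (fun v : V1 m n => (fderiv ℝ (c'.changeBase c)
      (c.changeBase c' v.1) (e i)) k • v.2.2 k) (c.coord1 j) := by
    intro i k
    have a : ContDiffAt ℝ ∞ (fun v : V1 m n => (fderiv ℝ (c'.changeBase c)
        (c.changeBase c' v.1) (e i)) k) (c.coord1 j) :=
      (EuclideanSpace.proj k : X m →L[ℝ] ℝ).contDiff.comp_contDiffAt _ (h6 i)
    have b : ContDiffAt ℝ ∞ (fun v : V1 m n => v.2.2 k) (c.coord1 j) := by fun_prop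
    exact a.smul b
  refine h1'.prodMk ((contDiffAt_snd.comp (c.coord1 j) h2').prodMk (contDiffAt_pi.2 fun i => ?_))
  exact contDiffAt_snd.comp (c.coord1 j)
    (h4.clm_apply ((h6 i).prodMk (ContDiffAt.sum fun k _ => h7 i k)))

theorem differentiableAt_change1 {j : Jet m n π 1} (hj : j ∈ c.jetDom 1) (hj' : j ∈ c'.jetDom 1) :
    DifferentiableAt ℝ (c.change1 c') (c.coord1 j) :=
  (change1_eventuallyEq hj hj').differentiableAt_iff.2
    ((contDiffAt_changeFormula hj hj').differentiableAt (by simp))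

theorem fderiv_changeBase_comp {x : M} (hx : x ∈ c.base.source) (hx' : x ∈ c'.base.source)
    (v : X m) : fderiv ℝ (c.changeBase c') (c.base x)
      (fderiv ℝ (c'.changeBase c) (c'.base x) v) = v := by
  have h1 := ((contDiffAt_changeBase hx hx').differentiableAt (by simp)).hasFDerivAt
  have h2 := ((contDiffAt_changeBase hx' hx).differentiableAt (by simp)).hasFDerivAt
  rw [← changeBase_apply (c := c') (c' := c) hx'] at h1
  have h3 := h1.comp (c'.base x) h2
  have h4 : (c.changeBase c' ∘ c'.changeBase c) =ᶠ[𝓝 (c'.base x)] id := by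
    have h5 := c'.base.continuousAt_symm (c'.base.map_source hx')
    filter_upwards [c'.base.open_target.mem_nhds (c'.base.map_source hx'),
      h5.eventually_mem (c.base.open_source.mem_nhds (by rwa [c'.base.left_inv hx']))]
      with y hy hy'
    simp [changeBase, c.base.left_inv hy', c'.base.right_inv hy]
  have h5 := h3.unique ((hasFDerivAt_id _).congr_of_eventuallyEq h4)
  rw [changeBase_apply hx'] at h5
  exact congrArg (fun A : X m →L[ℝ] X m => A v) h5

/-- The derivative of a change of coordinates in the fibre direction. -/
def fibreDeriv (c c' : AdaptedChart m n π) (z : X m × U n) : U n →ₗ[ℝ] U n :=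
  ((ContinuousLinearMap.snd ℝ _ _ ∘L fderiv ℝ (c.changeTotal c') z ∘L
    ContinuousLinearMap.inr ℝ _ _ : U n →L[ℝ] U n) : U n →ₗ[ℝ] U n)

/-- The new base coordinates depend on the old ones alone, and for fixed `x, u` the transition
formula is affine in the `u_i`, with linear part built from the inverse base Jacobian and the fibre
derivative. -/
theorem isProlonged_fderiv_change1 {j : Jet m n π 1} (hj : j ∈ c.jetDom 1)
    (hj' : j ∈ c'.jetDom 1) :
    IsProlonged (fderiv ℝ (c.change1 c') (c.coord1 j))
      (fderiv ℝ (c.changeBase c') (c.base j.base) : X m →ₗ[ℝ] X m)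
      (fderiv ℝ (c'.changeBase c) (c'.base j.base) : X m →ₗ[ℝ] X m)
      (fibreDeriv c c' (c.total j.point)) := by
  have hb := jet_base_mem hj
  have hb' := jet_base_mem hj'
  have hA : HasFDerivAt (c.changeFormula c') (fderiv ℝ (c.change1 c') (c.coord1 j))
      (c.coord1 j) :=
    (differentiableAt_change1 hj hj').hasFDerivAt.congr_of_eventuallyEq
      (change1_eventuallyEq hj hj').symm
  refine ⟨fun v => ?_, fun w => ?_, fun x => ?_⟩
  · have h1 : HasFDerivAt (fun v : V1 m n => c.changeBase c' v.1) _ (c.coord1 j) :=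
      HasFDerivAt.comp (g := Prod.fst) (f := c.changeFormula c') (c.coord1 j) hasFDerivAt_fst hA
    have h2 := ((contDiffAt_changeBase hb hb').differentiableAt (by simp)).hasFDerivAt
    rw [← c.coord1_base hj] at h2
    have h3 := h1.unique (HasFDerivAt.comp (g := c.changeBase c') (f := Prod.fst) (c.coord1 j) h2 hasFDerivAt_fst)
    have h4 := congrArg (fun A : V1 m n →L[ℝ] X m => A v) h3
    rw [c.coord1_base hj] at h4
    exact h4
  -- The derivative in a pure `u_i` direction is computed along a line, where the formula is exactly
  -- affine.
  · have h1 : HasDerivAt (fun t : ℝ => c.changeFormula c' (c.coord1 j + t • (0, 0, w))) _ 0 :=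
      hA.hasLineDerivAt (0, 0, w)
    let B : V1 m n := (0, 0, fun k => fibreDeriv c c' (c.total j.point)
      (∑ i, (fderiv ℝ (c'.changeBase c) (c'.base j.base) (e k)) i • w i))
    have h2 : (fun t : ℝ => c.changeFormula c' (c.coord1 j + t • (0, 0, w))) =
        fun t => c.changeFormula c' (c.coord1 j) + t • B := by
      ext1 t
      have e1 : (c.coord1 j + t • ((0, 0, w) : V1 m n)).1 = (c.coord1 j).1 := by simp
      have e2 : (c.coord1 j + t • ((0, 0, w) : V1 m n)).2.1 = (c.coord1 j).2.1 := by simp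
      have e3 : (c.coord1 j + t • ((0, 0, w) : V1 m n)).2.2 = (c.coord1 j).2.2 + t • w := by simp
      simp only [changeFormula, e1, e2, e3]
      refine Prod.ext (by simp [B]) (Prod.ext (by simp [B]) ?_)
      ext1 i
      simp only [Pi.add_apply, Pi.smul_apply, smul_add, Finset.sum_add_distrib, B,
        Prod.snd_add, Prod.smul_snd, c.coord1_base hj, changeBase_apply hb]
      have e4 : ∀ (a : X m) (b b' : U n), ((a, b + b') : X m × U n) = (a, b) + (0, b') := by
        intro a b b'; simp
      rw [e4, map_add, Prod.snd_add]
      have e5 : ∀ a : X m, ∑ k, a k • t • w k = t • ∑ k, a k • w k := by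
        intro a; rw [Finset.smul_sum]; exact Finset.sum_congr rfl fun k _ => smul_comm _ _ _
      have e6 : ∀ b : U n, ((0, t • b) : X m × U n) = t • (0, b) := by intro b; simp
      rw [e5, e6, map_smul, Prod.smul_snd]
      have e7 : ((c.coord1 j).1, (c.coord1 j).2.1) = c.total j.point := c.coord1_total hj
      rw [← c.coord1_base hj, e7]
      rfl
    rw [h2] at h1
    have h3 : HasDerivAt (fun t : ℝ => c.changeFormula c' (c.coord1 j) + t • B) B 0 := by
      simpa using ((hasDerivAt_id (0 : ℝ)).smul_const B).const_add (c.changeFormula c' (c.coord1 j))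
    exact h1.unique h3
  · exact fderiv_changeBase_comp hb hb' x

theorem fderiv_change1_comp {j : Jet m n π 1} (hj : j ∈ c.jetDom 1) (hj' : j ∈ c'.jetDom 1)
    (hj'' : j ∈ c''.jetDom 1) : fderiv ℝ (c.change1 c'') (c.coord1 j) =
      (fderiv ℝ (c'.change1 c'') (c'.coord1 j)).comp (fderiv ℝ (c.change1 c') (c.coord1 j)) := by
  have h1 : c.change1 c'' =ᶠ[𝓝 (c.coord1 j)] c'.change1 c'' ∘ c.change1 c' := by
    filter_upwards [eventually_exists_coord1 hj
      (c'.total.open_source.inter c''.total.open_source) ⟨hj', hj''⟩]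
    rintro _ ⟨i, h1, ⟨h2, h3⟩, rfl⟩
    rw [Function.comp_apply, change1_coord1 h1 h2, change1_coord1 h1 h3, change1_coord1 h2 h3]
  rw [h1.fderiv_eq, fderiv_comp, change1_coord1 hj hj']
  · rw [change1_coord1 hj hj']; exact differentiableAt_change1 hj' hj''
  · exact differentiableAt_change1 hj hj'

theorem fderiv_change1_self {j : Jet m n π 1} (hj : j ∈ c.jetDom 1) :
    fderiv ℝ (c.change1 c) (c.coord1 j) = ContinuousLinearMap.id ℝ (V1 m n) := by
  have h1 : c.change1 c =ᶠ[𝓝 (c.coord1 j)] id := by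
    filter_upwards [eventually_exists_coord1 hj c.total.open_source hj]
    rintro _ ⟨i, h1, -, rfl⟩
    rw [change1_coord1 h1 h1]; rfl
  rw [h1.fderiv_eq, fderiv_id]

theorem contDiffAt_prolong1 {f : X m → U n} {x : X m} (hf : ContDiffAt ℝ ∞ f x) :
    ContDiffAt ℝ ∞ (prolong1 f) x := by
  have h := hf.fderiv_right (m := ∞) (by simp)
  exact contDiffAt_id.prodMk (hf.prodMk (contDiffAt_pi.2 fun i => h.clm_apply contDiffAt_const))

/-- The derivatives of the prolongations of a section in two charts. -/
theorem fderiv_prolong1_change {s : LocalSection m n π} (hs : s.toFun s.pt ∈ c.total.source)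
    (hs' : s.toFun s.pt ∈ c'.total.source) (v : X m) :
    fderiv ℝ (c.change1 c') (c.coord1 (Quotient.mk (jetSetoid m n π 1) s))
      (fderiv ℝ (prolong1 (c.localRep s.toFun)) (c.base s.pt) v) =
    fderiv ℝ (prolong1 (c'.localRep s.toFun)) (c'.base s.pt)
      (fderiv ℝ (c.changeBase c') (c.base s.pt) v) := by
  have hb := c.pt_mem hs
  have hb' := c'.pt_mem hs'
  have h1 : c.change1 c' ∘ prolong1 (c.localRep s.toFun) =ᶠ[𝓝 (c.base s.pt)]
      prolong1 (c'.localRep s.toFun) ∘ c.changeBase c' := by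
    have ev : ∀ᶠ x in 𝓝 s.pt, (s.toFun x ∈ c.total.source ∧ s.toFun x ∈ c'.total.source) ∧
        (∀ᶠ x' in 𝓝 x, ContMDiffAt (𝓡 m) 𝓘(ℝ, X m × U n) ∞ s.toFun x') ∧
        ∀ᶠ x' in 𝓝 x, π (s.toFun x') = x' :=
      ((c.eventually_mem hs).and (c'.eventually_mem hs')).and
        (s.smooth.eventually_nhds.and s.isSection.eventually_nhds)
    have h2 : Filter.Tendsto c.base.symm (𝓝 (c.base s.pt)) (𝓝 s.pt) := by
      have := (c.base.continuousAt_symm (c.base.map_source hb))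
      rwa [ContinuousAt, c.base.left_inv hb] at this
    filter_upwards [h2.eventually ev, c.base.open_target.mem_nhds (c.base.map_source hb)]
      with y ⟨⟨hy1, hy2⟩, hy3, hy4⟩ hy5
    -- Recentring the section at a nearby point gives the identity there from the transition of its
    -- jet, so it holds on a neighbourhood and can be differentiated.
    let t := s.shift (c.base.symm y) hy3 hy4
    have ht : t.toFun t.pt ∈ c.total.source := hy1
    have ht' : t.toFun t.pt ∈ c'.total.source := hy2
    have hpt : c.base t.pt = y := c.base.right_inv hy5
    have e1 := c.coord1_mk ht
    have e2 := c'.coord1_mk ht'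
    have e3 := change1_coord1 (c := c) (c' := c') (j := Quotient.mk _ t) ht ht'
    rw [e1, e2, hpt] at e3
    exact e3
  have hd1 := (contDiffAt_prolong1 (c.contDiffAt_localRep_pt hs)).differentiableAt (by simp)
  have hd2 := (contDiffAt_prolong1 (c'.contDiffAt_localRep_pt hs')).differentiableAt (by simp)
  have hd3 := differentiableAt_change1 (c := c) (c' := c')
    (j := Quotient.mk (jetSetoid m n π 1) s) hs hs'
  have hd4 := (contDiffAt_changeBase hb hb').differentiableAt (by simp)
  have h2 := h1.fderiv_eq (𝕜 := ℝ)
  rw [c.coord1_mk hs] at hd3 ⊢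
  rw [fderiv_comp _ hd3 hd1, fderiv_comp _ (by rw [changeBase_apply hb]; exact hd2) hd4,
    changeBase_apply hb] at h2
  exact congrArg (fun A : X m →L[ℝ] V1 m n => A v) h2

end AdaptedChart

end ChangeOfCoordinates

theorem minSmoothness_two_le : minSmoothness ℝ 2 ≤ (∞ : ℕ∞ω) := by
  rw [minSmoothness_of_isRCLikeNormedField]
  exact WithTop.coe_le_coe.2 (le_top : (2 : ℕ∞) ≤ ⊤)

/-! ### Multimomenta and their coordinates -/

section Momenta

variable {m n : ℕ} {M E : Type*}
  [TopologicalSpace M] [ChartedSpace (X m) M]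
  [TopologicalSpace E] [ChartedSpace (X m × U n) E]
  {π : E → M}

open Classical in
/-- The point of `J²π†` with a given expression in the chart `c`. -/
def dagOfCovector (c : AdaptedChart m n π) (j : Jet m n π 1) (hj : j ∈ c.jetDom 1)
    (ξ : SymMom m n) : Dag m n π :=
  ⟨{ jet := j
     form := fun c' => if j ∈ c'.jetDom 1 then
       (ξ : V1 m n [⋀^Fin m]→L[ℝ] ℝ).compContinuousLinearMap
         (fderiv ℝ (c'.change1 c) (c'.coord1 j)) else 0
     form_of_notMem := fun c' h => if_neg h
     compat := fun c₁ c₂ h₁ h₂ => by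
       rw [if_pos h₁, if_pos h₂, AdaptedChart.fderiv_change1_comp h₁ h₂ hj]
       rfl
     vertical := fun c' => by
       split_ifs with h
       · exact (AdaptedChart.isProlonged_fderiv_change1 h hj).vanishesOnTwoVertical ξ.2.1
       · exact (SymMom m n).zero_mem.1 }, fun c' => by
    dsimp only
    split_ifs with h
    · exact ((AdaptedChart.isProlonged_fderiv_change1 h hj).mem_symMom ξ.2).2
    · exact (SymMom m n).zero_mem.2⟩

theorem dagOfCovector_form (c : AdaptedChart m n π) (j : Jet m n π 1) (hj : j ∈ c.jetDom 1)
    (ξ : SymMom m n) : (dagOfCovector c j hj ξ).1.form c = ξ := by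
  rw [dagOfCovector]
  dsimp only
  rw [if_pos hj, AdaptedChart.fderiv_change1_self hj]
  rfl

theorem Dag.form_mem (ξ : Dag m n π) (c : AdaptedChart m n π) : ξ.1.form c ∈ SymMom m n :=
  ⟨ξ.1.vertical c, ξ.2 c⟩

/-- Equality in the quotient is a condition in every chart. One chart suffices because derivatives
of coordinate changes preserve semibasic covectors. -/
theorem mu_eq_iff {c : AdaptedChart m n π} {ξ ξ' : Dag m n π} (h : ξ.1.jet ∈ c.jetDom 1)
    (hjet : ξ.1.jet = ξ'.1.jet) :
    mu ξ = mu ξ' ↔ (coeffs (ξ.1.form c)).2 = (coeffs (ξ'.1.form c)).2 := by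
  rw [← isSemibasic_sub_iff (ξ.form_mem c) (ξ'.form_mem c)]
  constructor
  · intro hmu
    exact (Quotient.exact hmu).2 c
  · intro hs
    refine Quotient.sound ⟨hjet, fun c' => ?_⟩
    by_cases h' : ξ.1.jet ∈ c'.jetDom 1
    · have e1 := ξ.1.compat c' c h' h
      have e2 := ξ'.1.compat c' c (hjet ▸ h') (hjet ▸ h)
      have e3 : ξ.1.form c' - ξ'.1.form c' =
          (ξ.1.form c - ξ'.1.form c).compContinuousLinearMap
            (fderiv ℝ (c'.change1 c) (c'.coord1 ξ.1.jet)) := by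
        rw [e1, e2, hjet]; rfl
      rw [e3]
      exact (AdaptedChart.isProlonged_fderiv_change1 h' h).isSemibasic hs
    · rw [ξ.1.form_of_notMem c' h', ξ'.1.form_of_notMem c' (hjet ▸ h'), sub_self]
      intro v a _; rfl

namespace AdaptedChart

variable {c c' : AdaptedChart m n π}

theorem coordDDag_mu {ξ : Dag m n π} (h : ξ.1.jet ∈ c.jetDom 1) :
    c.coordDDag (mu ξ) = (c.coord1 ξ.1.jet, (coeffs (ξ.1.form c)).2) := by
  have h1 : (dagSetoid m n π) (Quotient.out (mu ξ)) ξ := Quotient.mk_out (s := dagSetoid m n π) ξ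
  have h2 : mu (Quotient.out (mu ξ) : Dag m n π) = mu ξ := Quotient.out_eq _
  have h3 := (mu_eq_iff (c := c) (by rw [h1.1]; exact h) h1.1).1 h2
  rw [← h3]
  rfl

theorem coordDDag_injOn (c : AdaptedChart m n π) : Set.InjOn c.coordDDag c.ddagDom := by
  intro w hw w' hw' h
  induction w using Quotient.inductionOn with | _ ξ => ?_
  induction w' using Quotient.inductionOn with | _ ξ' => ?_
  have hξ : ξ.1.jet ∈ c.jetDom 1 := hw
  have hξ' : ξ'.1.jet ∈ c.jetDom 1 := hw'
  change c.coordDDag (mu ξ) = c.coordDDag (mu ξ') at h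
  rw [coordDDag_mu hξ, coordDDag_mu hξ', Prod.mk.injEq] at h
  have hjet := c.coord1_injOn hξ hξ' h.1
  exact (mu_eq_iff hξ hjet).2 h.2

theorem coordDDag_mu_dagOfCovector {j : Jet m n π 1} (hj : j ∈ c.jetDom 1)
    (q : ℝ × (Fin m → Fin n → ℝ) × (Sym (Fin m) 2 → Fin n → ℝ)) :
    c.coordDDag (mu (dagOfCovector c j hj (covectorCLM m n q))) = (c.coord1 j, q.2) := by
  rw [coordDDag_mu (ξ := dagOfCovector c j hj (covectorCLM m n q)) hj, dagOfCovector_form,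
    covectorCLM_coe, coeffs_covector]
  rfl

/-- Near the coordinates of a point of `J²π‡`, all coordinates are attained. -/
theorem eventually_exists_coordDDag {w : DDag m n π} (hw : w ∈ c.ddagDom) :
    ∀ᶠ z in 𝓝 (c.coordDDag w), ∃ w' ∈ c.ddagDom, c.coordDDag w' = z := by
  have h := eventually_exists_coord1 (c := c) (j := w.jet) hw c.total.open_source hw
  have hfst : Filter.Tendsto Prod.fst (𝓝 (c.coordDDag w)) (𝓝 (c.coord1 w.jet)) :=
    (continuous_fst (X := V1 m n)
      (Y := (Fin m → Fin n → ℝ) × (Sym (Fin m) 2 → Fin n → ℝ))).continuousAt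
  filter_upwards [hfst.eventually h]
  rintro z ⟨j, hj, -, hz⟩
  refine ⟨mu (dagOfCovector c j hj (covectorCLM m n (0, z.2))), hj, ?_⟩
  rw [coordDDag_mu_dagOfCovector hj, hz]

theorem coord3_fst {j : Jet m n π 3} (hj : j ∈ c.jetDom 3) :
    (c.coord3 j).1 = c.coord2 (j.proj 2 (by norm_num)) := by
  induction j using Quotient.inductionOn with | _ s => ?_
  have hs : s.toFun s.pt ∈ c.total.source := hj
  rw [c.coord3_mk hs]
  exact (c.coord2_mk hs).symm

end AdaptedChart

/-! ### The pairing and the volume form under changes of charts -/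

/-- The coefficient of a volume form as a function of the base coordinates. -/
def volFun (η : VolumeForm m M) (c : AdaptedChart m n π) (y : X m) : ℝ :=
  η.form (c.base.symm y) (fun k => mfderiv (𝓡 m) (𝓡 m) c.base.symm y (e k : X m))

theorem volCoeff_eq_volFun (η : VolumeForm m M) (c : AdaptedChart m n π) (x : M) :
    c.volCoeff η x = volFun η c (c.base x) := rfl

variable {c c' : AdaptedChart m n π}

open AdaptedChart

/-- This factor is the same as in `pairing_change`, which makes the equation defining the
Hamiltonian submanifold independent of the chart. -/
theorem volCoeff_change [IsManifold (𝓡 m) ∞ M] (η : VolumeForm m M) {x : M}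
    (hx : x ∈ c.base.source) (hx' : x ∈ c'.base.source) :
    c.volCoeff η x = detX m (fun k => fderiv ℝ (c.changeBase c') (c.base x) (e k)) *
      c'.volCoeff η x := by
  let ηf : M → (X m [⋀^Fin m]→L[ℝ] ℝ) := η.form
  let D : AdaptedChart m n π → X m → (X m →L[ℝ] X m) := fun c y =>
    mfderiv (𝓡 m) (𝓡 m) c.base.symm y
  have hD : D c (c.base x) = (D c' (c'.base x)).comp (fderiv ℝ (c.changeBase c') (c.base x)) := by
    have h1 : c.base.symm =ᶠ[𝓝 (c.base x)] c'.base.symm ∘ c.changeBase c' := by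
      have h5 := c.base.continuousAt_symm (c.base.map_source hx)
      filter_upwards [h5.eventually_mem (c'.base.open_source.mem_nhds
        (by rwa [c.base.left_inv hx]))] with y hy
      simp [changeBase, c'.base.left_inv hy]
    have h2 : MDifferentiableAt (𝓡 m) (𝓡 m) c'.base.symm (c.changeBase c' (c.base x)) := by
      rw [changeBase_apply hx]
      exact (contMDiffAt_symm_of_mem_maximalAtlas c'.base_mem
        (c'.base.map_source hx')).mdifferentiableAt (by simp)
    have h3 : MDifferentiableAt (𝓡 m) (𝓡 m) (c.changeBase c') (c.base x) :=
      ((contDiffAt_changeBase hx hx').differentiableAt (by simp)).mdifferentiableAt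
    have h4 : D c (c.base x) = (D c' (c.changeBase c' (c.base x))).comp
        (mfderiv (𝓡 m) (𝓡 m) (c.changeBase c') (c.base x)) :=
      (h1.mfderiv_eq (I := 𝓡 m) (I' := 𝓡 m)).trans (mfderiv_comp (c.base x) h2 h3)
    rw [h4, changeBase_apply hx, mfderiv_eq_fderiv]
    rfl
  have e1 : c.volCoeff η x = ηf x (fun k => D c (c.base x) (e k)) := by
    change ηf (c.base.symm (c.base x)) (fun k => D c (c.base x) (e k)) = _
    rw [c.base.left_inv hx]
  have e2 : c'.volCoeff η x = ηf x (fun k => D c' (c'.base x) (e k)) := by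
    change ηf (c'.base.symm (c'.base x)) (fun k => D c' (c'.base x) (e k)) = _
    rw [c'.base.left_inv hx']
  rw [e1, e2, hD, mul_comm]
  exact alternating_eq_detX ((ηf x).toAlternatingMap.compLinearMap
    (D c' (c'.base x) : X m →ₗ[ℝ] X m)) fun k => fderiv ℝ (c.changeBase c') (c.base x) (e k)

theorem pairing_change {j : Jet m n π 2} {ξ : Dag m n π}
    (hξ : ξ.1.jet = j.proj 1 (by norm_num)) (hj : j ∈ c.jetDom 2) (hj' : j ∈ c'.jetDom 2) :
    pairing c j ξ = detX m (fun k => fderiv ℝ (c.changeBase c') (c.base j.base) (e k)) *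
      pairing c' j ξ := by
  have hr : Quotient.mk (jetSetoid m n π 2) j.rep = j := Quotient.out_eq j
  obtain ⟨s, hs⟩ : ∃ s, j.rep = s := ⟨_, rfl⟩
  rw [pairing, pairing, hs]
  rw [hs] at hr
  subst hr
  have h1 : s.toFun s.pt ∈ c.total.source := hj
  have h2 : s.toFun s.pt ∈ c'.total.source := hj'
  have hjet : ξ.1.jet = Quotient.mk (jetSetoid m n π 1) s := hξ
  have hc := ξ.1.compat c c' (by rw [hjet]; exact h1) (by rw [hjet]; exact h2)
  rw [hc, ContinuousAlternatingMap.compContinuousLinearMap_apply, hjet]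
  have : (fderiv ℝ (c.change1 c') (c.coord1 (Quotient.mk (jetSetoid m n π 1) s))) ∘
      (fun k => fderiv ℝ (prolong1 (c.localRep s.toFun)) (c.base s.pt) (e k)) =
      fun k => fderiv ℝ (prolong1 (c'.localRep s.toFun)) (c'.base s.pt)
        ((fderiv ℝ (c.changeBase c') (c.base s.pt) : X m →ₗ[ℝ] X m) (e k)) :=
    funext fun k => fderiv_prolong1_change h1 h2 (e k)
  rw [this, alternating_comp_detX]
  rfl

/-- The coordinate expression `p^i_α u^α_i + p^{ij}_α u^α_{1_i + 1_j}`. -/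
def momentumTerm (P : (Fin m → Fin n → ℝ) × (Sym (Fin m) 2 → Fin n → ℝ)) (z : V2 m n) : ℝ :=
  ∑ a, momMap P ((0, z.1.2.2 a, fun k => z.2 (idx2 a k)) : V1 m n) a

/-- The derivative of the prolongation sends `e a` to `(e a, u_a, u_{a k})`, a frame lifting the
base frame, so the value is `p` plus a trace. -/
theorem pairing_eq {j : Jet m n π 2} (hj : j ∈ c.jetDom 2) (ξ : Dag m n π) :
    pairing c j ξ = (coeffs (ξ.1.form c)).1 +
      momentumTerm (coeffs (ξ.1.form c)).2 (c.coord2 j) := by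
  have hr : Quotient.mk (jetSetoid m n π 2) j.rep = j := Quotient.out_eq j
  have hs : j.rep.toFun j.rep.pt ∈ c.total.source := by
    rw [← hr] at hj; exact hj
  have hf := c.contDiffAt_localRep_pt hs
  have hk : (2 : ℕ∞ω) ≤ ∞ := WithTop.coe_le_coe.2 (le_top : (2 : ℕ∞) ≤ ⊤)
  have hv : ∀ a, fderiv ℝ (prolong1 (c.localRep j.rep.toFun)) (c.base j.rep.pt) (e a) =
      (e a, (c.coord2 j).1.2.2 a, fun k => (c.coord2 j).2 (idx2 a k)) := by
    intro a
    have h1 : HasFDerivAt (c.localRep j.rep.toFun) _ (c.base j.rep.pt) :=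
      (hf.differentiableAt (by simp)).hasFDerivAt
    have h2 : HasFDerivAt (fderiv ℝ (c.localRep j.rep.toFun)) _ (c.base j.rep.pt) :=
      ((hf.fderiv_right (m := ∞) (by simp)).differentiableAt (by simp)).hasFDerivAt
    have h3 := (hasFDerivAt_id (𝕜 := ℝ) (c.base j.rep.pt)).prodMk (h1.prodMk
      (hasFDerivAt_pi.2 fun i : Fin m => h2.clm_apply (hasFDerivAt_const (e i : X m) _)))
    have h4 : HasFDerivAt (prolong1 (c.localRep j.rep.toFun)) _ (c.base j.rep.pt) := h3
    rw [h4.fderiv]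
    refine Prod.ext rfl (Prod.ext rfl ?_)
    ext1 k
    change _ = pderiv (idx2 a k) (c.localRep j.rep.toFun) (c.base j.rep.pt)
    rw [pderiv_idx2 (hf.of_le hk)]
    simp
  have hcov := covector_coeffs (ξ.form_mem c)
  rw [pairing]
  conv_lhs => rw [← hcov]
  rw [covector_frame _ _ (fun k => by rw [hv])]
  congr 1
  refine Finset.sum_congr rfl fun a _ => ?_
  rw [hv]
  rfl

theorem contDiff_momentumTerm :
    ContDiff ℝ ∞ fun p : ((Fin m → Fin n → ℝ) × (Sym (Fin m) 2 → Fin n → ℝ)) × V2 m n =>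
      momentumTerm p.1 p.2 := by
  simp only [momentumTerm, momMap_apply]
  fun_prop

/-! ### The Hamiltonian section in coordinates -/

variable {η : VolumeForm m M} {L : Jet m n π 2 → ℝ} {Υ : DDag m n π → Jet m n π 3}

/-- Both branches of the definition lie over the same first jet, so agreement of the local
expressions is not needed here. -/
theorem legendre_jet (j : Jet m n π 3) : (legendre η L j).jet = j.proj 1 (by norm_num) := by
  unfold legendre
  split_ifs with h
  · exact h.choose_spec.1
  · rfl

theorem IsLegendreSection.proj_eq (hΥ : IsLegendreSection η L Υ) (w : DDag m n π) :
    (Υ w).proj 1 (by norm_num) = w.jet := by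
  rw [← legendre_jet (η := η) (L := L), hΥ.legendre_apply]

theorem jetDom_proj {k r : ℕ} (hr : r ≤ k) (j : Jet m n π k) :
    j.proj r hr ∈ c.jetDom r ↔ j ∈ c.jetDom k := by
  induction j using Quotient.inductionOn with | _ s => ?_
  exact Iff.rfl

theorem proj_proj (j : Jet m n π 3) : (j.proj 2 (by norm_num)).proj 1 (by norm_num) =
    j.proj 1 (by norm_num) := by
  induction j using Quotient.inductionOn with | _ s => ?_
  rfl

theorem base_proj {k r : ℕ} (hr : r ≤ k) (j : Jet m n π k) : (j.proj r hr).base = j.base := by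
  induction j using Quotient.inductionOn with | _ s => ?_
  rfl

/-- Minus the Hamiltonian function, at a point of `J²π‡`. -/
def negHamiltonian (η : VolumeForm m M) (L : Jet m n π 2 → ℝ) (Υ : DDag m n π → Jet m n π 3)
    (c : AdaptedChart m n π) (w : DDag m n π) : ℝ :=
  L ((Υ w).proj 2 (by norm_num)) * c.volCoeff η (Υ w).base -
    momentumTerm (c.coordDDag w).2 (c.coord2 ((Υ w).proj 2 (by norm_num)))

/-- With the momenta prescribed by `w`, the coupling condition in one chart is an affine equation
for `p` with leading coefficient one. In any other chart both sides acquire the same Jacobian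
factor. -/
theorem exists_hamiltonianSection [IsManifold (𝓡 m) ∞ M] (hΥ : IsLegendreSection η L Υ)
    {w : DDag m n π} (hw : w ∈ c.ddagDom) :
    ∃ ξ : Dag m n π, mu ξ = w ∧ (Υ w, ξ) ∈ hamiltonianSubmanifold η L := by
  let ξ := dagOfCovector c w.jet hw (covectorCLM m n (negHamiltonian η L Υ c w, (c.coordDDag w).2))
  have hform : ξ.1.form c = covector (negHamiltonian η L Υ c w, (c.coordDDag w).2) :=
    dagOfCovector_form _ _ _ _
  have hjet := hΥ.proj_eq w
  have hξ : ξ.1.jet = ((Υ w).proj 2 (by norm_num)).proj 1 (by norm_num) := by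
    rw [proj_proj, hjet]; rfl
  have h3 : Υ w ∈ c.jetDom 3 := (jetDom_proj (r := 1) (by norm_num) (Υ w)).1 (by rw [hjet]; exact hw)
  have h2 : (Υ w).proj 2 (by norm_num) ∈ c.jetDom 2 := (jetDom_proj (by norm_num) (Υ w)).2 h3
  have hmu : mu ξ = w := c.coordDDag_injOn (x₁ := mu ξ) hw hw (c.coordDDag_mu_dagOfCovector hw _)
  refine ⟨ξ, hmu, hjet.symm, ?_⟩
  intro c' hc'
  have h2' : (Υ w).proj 2 (by norm_num) ∈ c'.jetDom 2 := (jetDom_proj (by norm_num) (Υ w)).2 hc'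
  have hb := jet_base_mem (c := c) (j := (Υ w).proj 1 (by norm_num)) (by rw [hjet]; exact hw)
  have hb' := jet_base_mem (c := c') (j := (Υ w).proj 1 (by norm_num))
    ((jetDom_proj (by norm_num) (Υ w)).2 hc')
  rw [base_proj] at hb hb'
  have e1 : pairing c ((Υ w).proj 2 (by norm_num)) ξ =
      L ((Υ w).proj 2 (by norm_num)) * c.volCoeff η (Υ w).base := by
    rw [pairing_eq h2, hform, coeffs_covector, negHamiltonian]
    ring
  change pairing c' ((Υ w).proj 2 (by norm_num)) ξ = _
  rw [pairing_change hξ h2' h2, e1, base_proj, volCoeff_change η hb' hb]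
  ring

/-- This is the uniqueness half: the class `w` fixes the momenta and the coupling condition fixes
`p`, whichever element was chosen. -/
theorem coordDag_hamiltonianSection [IsManifold (𝓡 m) ∞ M] (hΥ : IsLegendreSection η L Υ)
    {w : DDag m n π} (hw : w ∈ c.ddagDom) :
    c.coordDag (hamiltonianSection η L Υ w) = ((c.coordDDag w).1,
      covectorCLM m n (negHamiltonian η L Υ c w, (c.coordDDag w).2)) := by
  have h := exists_hamiltonianSection hΥ hw
  obtain ⟨hmu, hsub⟩ : mu (hamiltonianSection η L Υ w) = w ∧
      (Υ w, hamiltonianSection η L Υ w) ∈ hamiltonianSubmanifold η L := by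
    rw [hamiltonianSection, dif_pos h]
    exact h.choose_spec
  set ξ := hamiltonianSection η L Υ w
  have hξjet : ξ.1.jet = w.jet := congrArg DDag.jet hmu
  have hξ : ξ.1.jet ∈ c.jetDom 1 := by rw [hξjet]; exact hw
  have hjet := hΥ.proj_eq w
  have h3 : Υ w ∈ c.jetDom 3 := (jetDom_proj (r := 1) (by norm_num) (Υ w)).1 (by rw [hjet]; exact hw)
  have h2 : (Υ w).proj 2 (by norm_num) ∈ c.jetDom 2 := (jetDom_proj (by norm_num) (Υ w)).2 h3
  have hcoord := c.coordDDag_mu hξ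
  rw [hmu] at hcoord
  have hp := hsub.2 c h3
  rw [pairing_eq h2] at hp
  have hcoe : coeffs (ξ.1.form c) = (negHamiltonian η L Υ c w, (c.coordDDag w).2) := by
    refine Prod.ext ?_ ?_
    · rw [negHamiltonian, hcoord, ← hp]; simp
    · rw [hcoord]
  refine Prod.ext (by rw [hcoord]; rfl) (Subtype.ext ?_)
  rw [covectorCLM_coe, ← hcoe, covector_coeffs (ξ.form_mem c)]
  rfl

end Momenta

/-! ### Local form of the Hamilton–Cartan form -/

section Hamiltonian

variable {m n : ℕ} {M E : Type*}
  [TopologicalSpace M] [ChartedSpace (X m) M]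
  [TopologicalSpace E] [ChartedSpace (X m × U n) E]
  {π : E → M} {c : AdaptedChart m n π}
  {η : VolumeForm m M} {L : Jet m n π 2 → ℝ} {Υ : DDag m n π → Jet m n π 3}

open AdaptedChart

/-- The local expression of minus the Hamiltonian function. -/
def negHamiltonianLocal (η : VolumeForm m M) (L : Jet m n π 2 → ℝ)
    (Υ : DDag m n π → Jet m n π 3) (c : AdaptedChart m n π) (z : VDDag m n) : ℝ :=
  localExpr (c.jetDom 2) c.coord2 L
    (localExpr c.ddagDom c.coordDDag (fun w => c.coord3 (Υ w)) z).1 * volFun η c z.1.1 -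
  momentumTerm z.2 (localExpr c.ddagDom c.coordDDag (fun w => c.coord3 (Υ w)) z).1

theorem negHamiltonianLocal_coord (hΥ : IsLegendreSection η L Υ) {w : DDag m n π}
    (hw : w ∈ c.ddagDom) :
    negHamiltonianLocal η L Υ c (c.coordDDag w) = negHamiltonian η L Υ c w := by
  have hjet := hΥ.proj_eq w
  have h3 : Υ w ∈ c.jetDom 3 := (jetDom_proj (r := 1) (by norm_num) (Υ w)).1 (by rw [hjet]; exact hw)
  have h2 : (Υ w).proj 2 (by norm_num) ∈ c.jetDom 2 := (jetDom_proj (by norm_num) (Υ w)).2 h3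
  rw [negHamiltonianLocal, localExpr_apply _ c.coordDDag_injOn hw, coord3_fst h3,
    localExpr_apply _ c.coord2_injOn h2, negHamiltonian, volCoeff_eq_volFun]
  have hb : (c.coordDDag w).1.1 = c.base (Υ w).base := by
    rw [← base_proj (r := 1) (by norm_num) (Υ w), hjet]
    exact c.coord1_base hw
  rw [hb]

theorem contDiffAt_momentumTerm {Φ : VDDag m n → V2 m n} {z : VDDag m n}
    (hΦ : ContDiffAt ℝ ∞ Φ z) : ContDiffAt ℝ ∞ (fun z => momentumTerm z.2 (Φ z)) z :=
  contDiff_momentumTerm.comp_contDiffAt (f := fun z : VDDag m n => (z.2, Φ z)) z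
    (contDiffAt_snd.prodMk hΦ)

theorem contDiffAt_negHamiltonianLocal (hL : SmoothOnJet2 L) (hΥ : IsLegendreSection η L Υ)
    {w : DDag m n π} (hw : w ∈ c.ddagDom) :
    ContDiffAt ℝ ∞ (negHamiltonianLocal η L Υ c) (c.coordDDag w) := by
  have hjet := hΥ.proj_eq w
  have h3 : Υ w ∈ c.jetDom 3 := (jetDom_proj (r := 1) (by norm_num) (Υ w)).1 (by rw [hjet]; exact hw)
  have h2 : (Υ w).proj 2 (by norm_num) ∈ c.jetDom 2 := (jetDom_proj (by norm_num) (Υ w)).2 h3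
  have hΥ1 : ContDiffAt ℝ ∞ (fun z => (localExpr c.ddagDom c.coordDDag
      (fun w => c.coord3 (Υ w)) z).1) (c.coordDDag w) :=
    contDiffAt_fst.comp (c.coordDDag w) (hΥ.smooth c w hw)
  have hval : (localExpr c.ddagDom c.coordDDag (fun w => c.coord3 (Υ w)) (c.coordDDag w)).1 =
      c.coord2 ((Υ w).proj 2 (by norm_num)) := by
    rw [localExpr_apply _ c.coordDDag_injOn hw, coord3_fst h3]
  have hL1 : ContDiffAt ℝ ∞ (fun z => localExpr (c.jetDom 2) c.coord2 L
      (localExpr c.ddagDom c.coordDDag (fun w => c.coord3 (Υ w)) z).1) (c.coordDDag w) := by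
    refine ContDiffAt.comp (g := localExpr (c.jetDom 2) c.coord2 L) (c.coordDDag w) ?_ hΥ1
    rw [hval]
    exact hL c _ h2
  have hη : ContDiffAt ℝ ∞ (volFun η c) (c.coordDDag w).1.1 := by
    have : (c.coordDDag w).1.1 ∈ c.base.target := by
      have : (c.coordDDag w).1.1 = c.base w.jet.base := c.coord1_base hw
      rw [this]
      exact c.base.map_source (jet_base_mem hw)
    exact (η.smooth c.base c.base_mem).contDiffAt (c.base.open_target.mem_nhds this)
  have hη1 : ContDiffAt ℝ ∞ (fun z : VDDag m n => volFun η c z.1.1) (c.coordDDag w) :=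
    ContDiffAt.comp (g := volFun η c) (f := fun z : VDDag m n => z.1.1) (c.coordDDag w) hη
      (contDiffAt_fst.comp (c.coordDDag w) contDiffAt_fst)
  exact (hL1.mul hη1).sub (contDiffAt_momentumTerm hΥ1)

/-- The local expression of a Hamiltonian section. -/
def sectionOf (p : VDDag m n → ℝ) (z : VDDag m n) : VDag m n :=
  (z.1, covectorCLM m n (p z, z.2))

theorem hamiltonianLocal_eventuallyEq [IsManifold (𝓡 m) ∞ M] (hΥ : IsLegendreSection η L Υ)
    {w : DDag m n π} (hw : w ∈ c.ddagDom) :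
    hamiltonianLocal η L Υ c =ᶠ[𝓝 (c.coordDDag w)]
      sectionOf (negHamiltonianLocal η L Υ c) := by
  filter_upwards [eventually_exists_coordDDag hw]
  rintro _ ⟨w', hw', rfl⟩
  rw [hamiltonianLocal, localExpr_apply _ c.coordDDag_injOn hw', coordDag_hamiltonianSection hΥ hw',
    sectionOf, negHamiltonianLocal_coord hΥ hw']

theorem contDiffAt_sectionOf {p : VDDag m n → ℝ} {z : VDDag m n} (hp : ContDiffAt ℝ ∞ p z) :
    ContDiffAt ℝ ∞ (sectionOf p) z := by
  have h : ContDiff ℝ ∞ fun q => covectorCLM m n q := by fun_prop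
  have h' : ContDiffAt ℝ ∞ (fun z : VDDag m n => covectorCLM m n (p z, z.2)) z :=
    ContDiff.comp_contDiffAt (g := fun q => covectorCLM m n q) (f := fun z : VDDag m n => (p z, z.2))
      z h (hp.prodMk contDiffAt_snd)
  exact contDiffAt_fst.prodMk h'

/-- This is naturality of `d` under pullback; the tautological form is linear in the fibre variable,
hence differentiable. -/
theorem extDeriv_tautological_pullback {V S W : Type*} [NormedAddCommGroup V] [NormedSpace ℝ V]
    [NormedAddCommGroup S] [NormedSpace ℝ S] [NormedAddCommGroup W] [NormedSpace ℝ W]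
    (ι : S →L[ℝ] V [⋀^Fin m]→L[ℝ] ℝ) {f : W → V × S} {z : W} (hf : ContDiffAt ℝ ∞ f z) :
    extDeriv (fun x => ((ι (f x).2).compContinuousLinearMap
      (ContinuousLinearMap.fst ℝ V S)).compContinuousLinearMap (fderiv ℝ f x)) z =
    (extDeriv (fun q : V × S => (ι q.2).compContinuousLinearMap
      (ContinuousLinearMap.fst ℝ V S)) (f z)).compContinuousLinearMap (fderiv ℝ f z) := by
  let A : (V [⋀^Fin m]→L[ℝ] ℝ) →L[ℝ] ((V × S) [⋀^Fin m]→L[ℝ] ℝ) :=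
    ContinuousAlternatingMap.compContinuousLinearMapCLM (ContinuousLinearMap.fst ℝ V S)
  have h : Differentiable ℝ (fun q : V × S => (ι q.2).compContinuousLinearMap
      (ContinuousLinearMap.fst ℝ V S)) :=
    (A ∘L ι ∘L ContinuousLinearMap.snd ℝ V S).differentiable
  exact extDeriv_pullback (f := f) (h _) hf minSmoothness_two_le

theorem extDeriv_liouville_pullback {f : VDDag m n → VDag m n} {z : VDDag m n}
    (hf : ContDiffAt ℝ ∞ f z) :
    extDeriv (fun x => (liouville m n (f x)).compContinuousLinearMap (fderiv ℝ f x)) z =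
      -(liouvilleD m n (f z)).compContinuousLinearMap (fderiv ℝ f z) := by
  refine (extDeriv_tautological_pullback (V := V1 m n) (S := SymMom m n) (W := VDDag m n)
    (SymMom m n).subtypeL hf).trans ?_
  rw [liouvilleD]
  ext v
  exact (neg_neg _).symm

/-- The tautological form evaluates the covector on projections to first jets, and the section
leaves the first-jet component unchanged; derivatives of `p` therefore drop out. -/
theorem liouville_sectionOf {p : VDDag m n → ℝ} {z : VDDag m n} (hp : ContDiffAt ℝ ∞ p z) :
    (liouville m n (sectionOf p z)).compContinuousLinearMap (fderiv ℝ (sectionOf p) z) =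
      cartanForm p z := by
  have h1 : HasFDerivAt (sectionOf p) _ z :=
    ((contDiffAt_sectionOf hp).differentiableAt (by simp)).hasFDerivAt
  have h2 : HasFDerivAt (fun z : VDDag m n => z.1) _ z :=
    HasFDerivAt.comp (g := Prod.fst) (f := sectionOf p) z hasFDerivAt_fst h1
  have h3 := h2.unique hasFDerivAt_fst
  ext v
  change covector (p z, z.2) (fun k => (fderiv ℝ (sectionOf p) z (v k)).1) = _
  have : (fun k => (fderiv ℝ (sectionOf p) z (v k)).1) = fun k => (v k).1 :=
    funext fun k => congrArg (fun A : VDDag m n →L[ℝ] V1 m n => A (v k)) h3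
  rw [this]
  rfl

/-- Equality on a neighbourhood is required, since closedness differentiates the form once more. -/
theorem hamiltonCartan_eventuallyEq [IsManifold (𝓡 m) ∞ M] (hL : SmoothOnJet2 L)
    (hΥ : IsLegendreSection η L Υ) {w : DDag m n π} (hw : w ∈ c.ddagDom) :
    hamiltonCartan η L Υ c =ᶠ[𝓝 (c.coordDDag w)]
      fun z => -extDeriv (cartanForm (negHamiltonianLocal η L Υ c)) z := by
  have hsmooth : ∀ᶠ z in 𝓝 (c.coordDDag w),
      ContDiffAt ℝ ∞ (negHamiltonianLocal η L Υ c) z := by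
    filter_upwards [eventually_exists_coordDDag hw]
    rintro _ ⟨w', hw', rfl⟩
    exact contDiffAt_negHamiltonianLocal hL hΥ hw'
  filter_upwards [(hamiltonianLocal_eventuallyEq hΥ hw).eventually_nhds, hsmooth.eventually_nhds]
    with z hz hp
  have h1 : extDeriv (cartanForm (negHamiltonianLocal η L Υ c)) z =
      extDeriv (fun z => (liouville m n (sectionOf (negHamiltonianLocal η L Υ c) z)
        ).compContinuousLinearMap (fderiv ℝ (sectionOf (negHamiltonianLocal η L Υ c)) z)) z := by
    refine Filter.EventuallyEq.extDeriv_eq ?_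
    filter_upwards [hp] with y hy
    exact (liouville_sectionOf hy).symm
  have hz' : hamiltonianLocal η L Υ c =ᶠ[𝓝 z] sectionOf (negHamiltonianLocal η L Υ c) := hz
  rw [h1, extDeriv_liouville_pullback (contDiffAt_sectionOf hp.self_of_nhds), hamiltonCartan,
    hz'.fderiv_eq, hz'.self_of_nhds]
  exact (neg_neg _).symm

end Hamiltonian

end SecondOrderField

end

/-! ### Multisymplecticity of the Hamilton–Cartan form -/

theorem mainTheorem9 {m n : ℕ} (hm : 2 ≤ m) (hn : 1 ≤ n) {M E : Type*}
    [TopologicalSpace M] [ChartedSpace (SecondOrderField.X m) M] [IsManifold (𝓡 m) ∞ M]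
    [TopologicalSpace E] [ChartedSpace (SecondOrderField.X m × SecondOrderField.U n) E]
    [IsManifold 𝓘(ℝ, SecondOrderField.X m × SecondOrderField.U n) ∞ E]
    (π : E → M) (hπ : SecondOrderField.IsFibredManifold m n π)
    (η : SecondOrderField.VolumeForm m M)
    (L : SecondOrderField.Jet m n π 2 → ℝ) (hL : SecondOrderField.SmoothOnJet2 L)
    (hreg : SecondOrderField.IsHyperregular η L)
    (Υ : SecondOrderField.DDag m n π → SecondOrderField.Jet m n π 3)
    (hΥ : SecondOrderField.IsLegendreSection η L Υ) :
    SecondOrderField.IsMultisymplectic (SecondOrderField.hamiltonCartan η L Υ) := by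
  open SecondOrderField in
  refine ⟨?_, fun c w hw => ?_⟩
  -- The base and fibre coordinates alone contribute `m + n ≥ m + 1` to the dimension.
  · simp only [Module.finrank_prod, finrank_euclideanSpace, Fintype.card_fin,
      Module.finrank_pi_fintype, Finset.sum_const, Finset.card_univ, smul_eq_mul]
    omega
  have hΩ := hamiltonCartan_eventuallyEq hL hΥ hw
  have hp := contDiffAt_negHamiltonianLocal hL hΥ hw
  have hΘ := contDiffAt_cartanForm hp
  refine ⟨?_, ?_, fun Y => ⟨fun h => ?_, ?_⟩⟩
  · refine ContDiffAt.congr_of_eventuallyEq ?_ hΩ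
    refine ContDiffAt.neg ?_
    exact (ContinuousAlternatingMap.alternatizeUncurryFinCLM ℝ (VDDag m n) ℝ).contDiff.comp_contDiffAt
      _ (hΘ.fderiv_right (m := ∞) (by simp))
  · rw [hΩ.extDeriv_eq]
    have h1 : (fun z => -extDeriv (cartanForm (negHamiltonianLocal η L Υ c)) z) =
        (-1 : ℝ) • extDeriv (cartanForm (negHamiltonianLocal η L Υ c)) := by
      ext1 z; simp
    rw [h1, extDeriv_smul, extDeriv_extDeriv_apply hΘ minSmoothness_two_le, smul_zero]
  · refine cartanForm_nondegenerate hm hn hp fun v => ?_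
    have := h v
    rw [hΩ.self_of_nhds] at this
    simpa using this
  · rintro rfl v
    exact ContinuousAlternatingMap.map_coord_zero _ 0 (by simp)
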